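/- \textbf{Lemma (Decoupling inequality).} Let $c>0$ and put $$F_c(x)=e^{c(\log x)^{1/2}}\ (x\ge 1),\qquad F_c(0)=1,\qquad \widetilde c=\max\Big\{e^{\left(\frac{\log 2}{c}\right)^2},\,e^{1/2}\Big\}.$$ Let $\xi$ be an integer-valued random variable which almost surely takes values greater than $\widetilde c$, which is aperiodic, i.e. $\gcd\{k\ge 1:\mathbb P(\xi=k)>0\}=1$, and which satisfies $\mathbb E[\xi F_c(\xi)]<\infty$. Let $\xi_1,\xi_2,\dots$ be i.i.d. copies of $\xi$, and let $\rho$ be a random variable with values in $\{0,1,2,\dots\}$, independent of $(\xi_i)_{i\ge1}$, with the stationary delay distribution $$\mathbb P(\rho=k)=\frac{1}{\mathbb E[\xi]}\sum_{i=k+1}^{\infty}\mathbb P(\xi=i),\qquad k\ge 0.$$ Define $X_0=\rho$, $X_i=X_{i-1}+\xi_i$ for $i\ge1$, and $$Z_n=\min\{X_i-n:\ i\ge 0,\ X_i-n\ge 0\},\qquad n\ge 0,$$ and let $\mu_\xi^\rho$ denote the probability law governing this process. Then there is a constant $c_1=c_1(\xi,c)>0$, depending only on $\xi$ and $c$, such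 that for all integers $n,m\ge 0$ and all events $$A\in\sigma(Z_j:0\le j\le m),\qquad B\in\sigma(Z_j: j\ge m+2n),$$ we have $$\mu_\xi^\rho(A\cap B)\le \mu_\xi^\rho(A)\,\mu_\xi^\rho(B)+\frac{c_1}{F_c(n)}.$$ -/

import Mathlib

open MeasureTheory ProbabilityTheory

namespace RenewalDecoupling

/-- The function `F_c(x) = exp (c (log x)^{1/2})`, meant for `x ≥ 1`.
With Mathlib's convention `log 0 = 0` it also takes the value `1` at `x = 0`. -/
noncomputable def F (c x : ℝ) : ℝ := Real.exp (c * Real.sqrt (Real.log x))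

/-- The threshold `max {exp ((log 2 / c)^2), exp (1/2)}`. -/
noncomputable def cTilde (c : ℝ) : ℝ :=
  max (Real.exp ((Real.log 2 / c) ^ 2)) (Real.exp (1 / 2))

/-- An integer-valued random variable `ξ` is aperiodic if
`gcd {k ≥ 1 : P(ξ = k) > 0} = 1`. -/
def Aperiodic {Ω : Type*} [MeasurableSpace Ω] (P : Measure Ω) (ξ : Ω → ℕ) : Prop :=
  Nat.setGcd {k : ℕ | 1 ≤ k ∧ 0 < P {ω | ξ ω = k}} = 1

/-- The stationary delay weights `λ_k = (1 / E ξ) ∑_{i ≥ k+1} P(ξ = i)`. -/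
noncomputable def stationaryWeight {Ω : Type*} [MeasurableSpace Ω] (P : Measure Ω)
    (ξ : Ω → ℕ) (k : ℕ) : ℝ :=
  (1 / ∫ ω, (ξ ω : ℝ) ∂P) * ∑' i : ℕ, P.real {ω | ξ ω = k + 1 + i}

/-- The renewal process `X_0 = χ`, `X_{i+1} = X_i + ξ_{i+1}`; the interarrival time
`ξ_{i+1}` is `ξs i`. -/
def renewalX {Ω : Type*} (χ : Ω → ℕ) (ξs : ℕ → Ω → ℕ) : ℕ → Ω → ℕ
  | 0, ω => χ ω
  | i + 1, ω => renewalX χ ξs i ω + ξs i ω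

/-- The process `Z_n = min {X_i - n : i ≥ 0, X_i - n ≥ 0}`. -/
noncomputable def renewalZ {Ω : Type*} (χ : Ω → ℕ) (ξs : ℕ → Ω → ℕ) (n : ℕ) (ω : Ω) : ℕ :=
  sInf {k : ℕ | ∃ i : ℕ, n ≤ renewalX χ ξs i ω ∧ k = renewalX χ ξs i ω - n}

/-- The σ-algebra `σ(Z_j : j ∈ J)` generated by the variables `Z_j`, `j ∈ J`. -/
abbrev sigmaOf {Ω : Type*} (Z : ℕ → Ω → ℕ) (J : Set ℕ) : MeasurableSpace Ω :=
  ⨆ j ∈ J, MeasurableSpace.comap (Z j) ⊤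

/-- `χ` and `ξs` are the ingredients, on the probability space `(Ω, μ)`, of a renewal process
whose interarrival times are independent copies of `ξ` (a variable on `(Ω₀, P)`)
and whose delay `χ` is independent of all of them. -/
structure IsRenewalInput {Ω₀ Ω : Type*} [MeasurableSpace Ω₀] [MeasurableSpace Ω]
    (P : Measure Ω₀) (ξ : Ω₀ → ℕ) (μ : Measure Ω) (χ : Ω → ℕ) (ξs : ℕ → Ω → ℕ) : Prop where
  measurable_delay : Measurable χ
  measurable_interarrival : ∀ i, Measurable (ξs i)
  identDistrib : ∀ i, IdentDistrib (ξs i) ξ μ P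
  iIndepFun : iIndepFun ξs μ
  indep_delay : IndepFun χ (fun ω i => ξs i ω) μ

/-- The random variable `χ` on `(Ω, μ)` is distributed as the stationary delay of `ξ`. -/
def IsStationaryDelay {Ω₀ Ω : Type*} [MeasurableSpace Ω₀] [MeasurableSpace Ω]
    (P : Measure Ω₀) (ξ : Ω₀ → ℕ) (μ : Measure Ω) (χ : Ω → ℕ) : Prop :=
  ∀ k : ℕ, μ.real {ω | χ ω = k} = stationaryWeight P ξ k

end RenewalDecoupling

/-!
Let `p` be the law of `ξ`, `t k = P(ξ > k)` its tails and `M = E ξ = ∑ t k`, so that the stationary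
delay has weights `t k / M`. The process `Z` is a Markov chain: it moves down by one until it hits
`0` and then jumps to `l` with probability `p (l + 1)`; the stationary delay is its stationary
distribution. Everything is measured with the weight `w n = F c (n + 1)`, which is submultiplicative
because `i + j + 1 ≤ (i + 1) (j + 1)` and the square root is subadditive. The moment condition
`E[ξ F(ξ)] < ∞` gives `∑ t k * w k < ∞` (`summable_tailSum_mul_weight`).

The analytic core is the renewal theorem with a rate, `|u n - 1 / M| ≤ C / w n`, for the probability
`u n` of a renewal at time `n` when the delay is zero (`renewal_rate`). The generating functions
satisfy `U (1 - X) T = 1` with `T = ∑ t k X^k`. The series `T` lies in the Beurling algebra of power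
series with `∑ |f n| w n < ∞`, and by aperiodicity it has no zero in the closed unit disc
(`IsAperiodicLaw.tail_ne_zero`). As `w` grows slower than any geometric progression, all characters
of this Banach algebra are evaluations at points of the closed disc, so `T` has an inverse `H` in
the algebra by Gelfand theory (`beurling_isUnit`). Hence `u n` is the partial sum `∑_{k ≤ n} h k`,
its limit is `1 / M`, and the error is a tail of `∑ h k`, which is at most `‖H‖ / w n`.

Decomposing `Z j` at the last renewal before `j` turns this rate into a bound `C / w j` for the
total variation distance between the zero-delay process after time `j` and the stationary process
(`pathLaw_zero_shift_le`). For the decoupling inequality (`decoupling_path`), condition on `Z m = k`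
by the Markov property. If `k < n`, the process restarts from a renewal at time `m + k`, which
leaves at least `n` time units until `m + 2 n`. The event `Z m ≥ n` has, by stationarity, the
probability `∑_{k ≥ n} t k / M`, which is `O(1 / w n)`.
-/

namespace RenewalDecoupling

open scoped ENNReal

/-! ### The Beurling algebra of a weight -/

section BeurlingAlgebra


/-- A submultiplicative weight `w ≥ 1` on `ℕ`, normalised by `w 0 = 1`, which grows slower than
every geometric progression. -/
structure IsBeurlingWeight (w : ℕ → ℝ) : Prop where
  zero : w 0 = 1
  one_le : ∀ n, 1 ≤ w n
  submul : ∀ i j, w (i + j) ≤ w i * w j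
  subexp : ∀ r : ℝ, 1 < r → ∃ n, w n < r ^ n

theorem IsBeurlingWeight.pos {w : ℕ → ℝ} (hw : IsBeurlingWeight w) (n : ℕ) : 0 < w n :=
  zero_lt_one.trans_le (hw.one_le n)

theorem IsBeurlingWeight.norm_coeff_mul_le {w : ℕ → ℝ} (hw : IsBeurlingWeight w)
    (f g : PowerSeries ℂ) (n : ℕ) :
    ‖PowerSeries.coeff n (f * g)‖ * w n ≤
      ∑ kl ∈ Finset.HasAntidiagonal.antidiagonal n, ‖PowerSeries.coeff kl.1 f‖ * w kl.1 *
        (‖PowerSeries.coeff kl.2 g‖ * w kl.2) := by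
  rw [PowerSeries.coeff_mul]
  calc _ ≤ (∑ kl ∈ Finset.HasAntidiagonal.antidiagonal n,
        ‖PowerSeries.coeff kl.1 f * PowerSeries.coeff kl.2 g‖) * w n :=
        mul_le_mul_of_nonneg_right (norm_sum_le _ _) (hw.pos n).le
    _ = ∑ kl ∈ Finset.HasAntidiagonal.antidiagonal n,
        ‖PowerSeries.coeff kl.1 f‖ * ‖PowerSeries.coeff kl.2 g‖ * w n := by
        rw [Finset.sum_mul]; simp only [norm_mul]
    _ ≤ _ := by
        refine Finset.sum_le_sum fun kl hkl => ?_
        rw [Finset.HasAntidiagonal.mem_antidiagonal] at hkl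
        rw [mul_mul_mul_comm, ← hkl]
        gcongr
        exact hw.submul _ _

theorem summable_weighted_mul {w : ℕ → ℝ} {f g : PowerSeries ℂ}
    (hf : Summable fun n => ‖PowerSeries.coeff n f‖ * w n)
    (hg : Summable fun n => ‖PowerSeries.coeff n g‖ * w n) :
    Summable fun n => ∑ kl ∈ Finset.HasAntidiagonal.antidiagonal n,
      ‖PowerSeries.coeff kl.1 f‖ * w kl.1 * (‖PowerSeries.coeff kl.2 g‖ * w kl.2) :=
  (summable_norm_sum_mul_antidiagonal_of_summable_norm hf.norm hg.norm).of_norm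

/-- The Beurling algebra of `w`: the power series `∑ fₙ Xⁿ` over `ℂ` with `∑ |fₙ| w n < ∞`. -/
noncomputable def beurling (w : ℕ → ℝ) (hw : IsBeurlingWeight w) :
    Subalgebra ℂ (PowerSeries ℂ) where
  carrier := {f | Summable fun n => ‖PowerSeries.coeff n f‖ * w n}
  mul_mem' {f g} hf hg :=
    (summable_weighted_mul hf hg).of_nonneg_of_le
      (fun n => mul_nonneg (norm_nonneg _) (hw.pos n).le) (hw.norm_coeff_mul_le f g)
  add_mem' {f g} hf hg := by
    refine (hf.add hg).of_nonneg_of_le (fun n => mul_nonneg (norm_nonneg _) (hw.pos n).le)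
      fun n => ?_
    rw [map_add, ← add_mul]
    exact mul_le_mul_of_nonneg_right (norm_add_le _ _) (hw.pos n).le
  algebraMap_mem' r := by
    refine summable_of_ne_finset_zero (s := {0}) fun n hn => ?_
    rw [PowerSeries.algebraMap_apply, PowerSeries.coeff_C,
      if_neg (by simpa using hn)]
    simp

variable {w : ℕ → ℝ} {hw : IsBeurlingWeight w}

theorem mem_beurling {f : PowerSeries ℂ} :
    f ∈ beurling w hw ↔ Summable fun n => ‖PowerSeries.coeff n f‖ * w n := Iff.rfl

theorem memℓp_beurling (f : beurling w hw) :
    Memℓp (fun n => (w n : ℂ) * PowerSeries.coeff n f.1) 1 := by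
  rw [memℓp_gen_iff (by simp)]
  refine (mem_beurling.1 f.2).congr fun n => ?_
  simp [abs_of_pos (hw.pos n), mul_comm]

/-- The identification of the Beurling algebra with `ℓ¹` by `f ↦ (w n * fₙ)ₙ`. -/
noncomputable def beurlingToLp : beurling w hw →ₗ[ℂ] lp (fun _ : ℕ => ℂ) 1 where
  toFun f := ⟨fun n => (w n : ℂ) * PowerSeries.coeff n f.1, memℓp_beurling f⟩
  map_add' f g := by
    ext n
    exact (congrArg _ (map_add _ _ _)).trans (mul_add _ _ _)
  map_smul' r f := by ext n; simp; ring

theorem beurlingToLp_injective : Function.Injective (beurlingToLp (hw := hw)) := by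
  intro f g h
  ext n
  have := congrArg (fun a : lp (fun _ : ℕ => ℂ) 1 => a n) h
  have h0 : (w n : ℂ) ≠ 0 := by exact_mod_cast (hw.pos n).ne'
  exact mul_left_cancel₀ h0 this

theorem beurlingToLp_surjective : Function.Surjective (beurlingToLp (hw := hw)) := by
  intro a
  have h0 : ∀ n, (w n : ℂ) ≠ 0 := fun n => by exact_mod_cast (hw.pos n).ne'
  refine ⟨⟨PowerSeries.mk fun n => a n / w n, ?_⟩, ?_⟩
  · have := (memℓp_gen_iff (p := 1) (by simp)).1 a.2
    refine mem_beurling.2 (this.congr fun n => ?_)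
    have := (hw.pos n).ne'
    simp [abs_of_pos (hw.pos n), this]
  · ext n
    simp only [beurlingToLp, LinearMap.coe_mk, AddHom.coe_mk, PowerSeries.coeff_mk]
    exact mul_div_cancel₀ _ (h0 n)

noncomputable instance : NormedAddCommGroup (beurling w hw) :=
  NormedAddCommGroup.induced _ _ (beurlingToLp (hw := hw)) beurlingToLp_injective

theorem beurling_norm_eq (f : beurling w hw) :
    ‖f‖ = ∑' n, ‖PowerSeries.coeff n f.1‖ * w n := by
  change ‖beurlingToLp f‖ = _
  rw [lp.norm_eq_tsum_rpow (by simp)]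
  simp [beurlingToLp, abs_of_pos (hw.pos _), mul_comm]

theorem beurlingToLp_isometry : Isometry (beurlingToLp (hw := hw)) :=
  AddMonoidHomClass.isometry_of_norm _ fun _ => rfl

instance : CompleteSpace (beurling w hw) :=
  (IsometryEquiv.mk (Equiv.ofBijective _ ⟨beurlingToLp_injective, beurlingToLp_surjective⟩)
    (beurlingToLp_isometry (hw := hw))).completeSpace

noncomputable instance : NormedCommRing (beurling w hw) where
  __ := (inferInstance : CommRing (beurling w hw))
  __ := (inferInstance : NormedAddCommGroup (beurling w hw))
  norm_mul_le f g := by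
    simp only [beurling_norm_eq]
    rw [tsum_mul_tsum_eq_tsum_sum_antidiagonal_of_summable_norm
      (mem_beurling.1 f.2).norm (mem_beurling.1 g.2).norm]
    exact (mem_beurling.1 (f * g).2).tsum_le_tsum (hw.norm_coeff_mul_le f.1 g.1)
      (summable_weighted_mul f.2 g.2)

noncomputable instance : NormedAlgebra ℂ (beurling w hw) where
  norm_smul_le r f := by
    simp only [beurling_norm_eq]
    rw [← tsum_mul_left]
    refine le_of_eq (tsum_congr fun n => ?_)
    simp [mul_assoc]

/-- The indeterminate as an element of the Beurling algebra. -/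
noncomputable def beurlingX : beurling w hw :=
  ⟨PowerSeries.X, mem_beurling.2 <| summable_of_ne_finset_zero (s := {1}) fun n hn => by
    rw [PowerSeries.coeff_X, if_neg (by simpa using hn)]; simp⟩

theorem beurlingX_pow_norm (n : ℕ) : ‖(beurlingX : beurling w hw) ^ n‖ = w n := by
  rw [beurling_norm_eq, tsum_eq_single n]
  · simp [beurlingX]
  · intro k hk
    simp [beurlingX, PowerSeries.coeff_X_pow, hk]

/-- The monomials span a dense subspace: an element of the algebra is the sum of its power series
in the norm of the algebra, so that a character is determined by its value at the indeterminate. -/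
theorem beurling_hasSum (f : beurling w hw) :
    HasSum (fun n => PowerSeries.coeff n f.1 • (beurlingX : beurling w hw) ^ n) f := by
  have hf := mem_beurling.1 f.2
  rw [HasSum, SummationFilter.unconditional_filter, tendsto_iff_norm_sub_tendsto_zero]
  have hnorm : ∀ s : Finset ℕ,
      ‖∑ n ∈ s, PowerSeries.coeff n f.1 • (beurlingX : beurling w hw) ^ n - f‖ =
        ∑' n : {n // n ∉ s}, ‖PowerSeries.coeff (n : ℕ) f.1‖ * w n := by
    intro s
    rw [beurling_norm_eq]
    refine Eq.trans ?_ (tsum_subtype {n | n ∉ s} (fun n => ‖PowerSeries.coeff n f.1‖ * w n)).symm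
    refine tsum_congr fun k => ?_
    have hk : PowerSeries.coeff k
        (∑ n ∈ s, PowerSeries.coeff n f.1 • (beurlingX : beurling w hw) ^ n).1 =
          if k ∈ s then PowerSeries.coeff k f.1 else 0 := by
      simp [beurlingX, PowerSeries.coeff_X_pow]
    by_cases hks : k ∈ s
    · rw [Set.indicator_of_notMem (by simpa using hks)]
      rw [AddSubgroupClass.coe_sub, map_sub, hk, if_pos hks]
      simp
    · rw [Set.indicator_of_mem (by simpa using hks)]
      rw [AddSubgroupClass.coe_sub, map_sub, hk, if_neg hks]
      simp
  simp only [hnorm]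
  exact tendsto_tsum_compl_atTop_zero (fun n => ‖PowerSeries.coeff n f.1‖ * w n)

/-- Wiener's lemma for Beurling algebras: a power series of the algebra without zeros in the
closed unit disc is invertible in the algebra. Every character is evaluation at some `z`, and
`‖zⁿ‖ ≤ w n` forces `‖z‖ ≤ 1`. -/
theorem beurling_isUnit (f : beurling w hw)
    (h : ∀ z : ℂ, ‖z‖ ≤ 1 → ∑' n, PowerSeries.coeff n f.1 * z ^ n ≠ 0) : IsUnit f := by
  by_contra hf
  obtain ⟨φ, hφ⟩ := WeakDual.CharacterSpace.exists_apply_eq_zero hf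
  set z := φ (beurlingX : beurling w hw) with hz
  have h1 : HasSum (fun n => PowerSeries.coeff n f.1 * z ^ n) (φ f) := by
    have := (beurling_hasSum f).map φ (map_continuous φ)
    refine this.congr_fun ?_ |> id
    intro n
    simp [hz]
  refine h z ?_ (h1.tsum_eq.trans hφ)
  have hone : ‖(1 : beurling w hw)‖ = 1 := by
    simpa [hw.zero] using beurlingX_pow_norm (hw := hw) 0
  by_contra! hz1
  obtain ⟨n, hn⟩ := hw.subexp _ hz1
  have h2 := (WeakDual.toStrongDual (φ : WeakDual ℂ (beurling w hw))).le_opNorm (beurlingX ^ n)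
  have h3 := WeakDual.CharacterSpace.norm_le_norm_one φ
  rw [hone] at h3
  rw [beurlingX_pow_norm] at h2
  have h4 : ‖z ^ n‖ ≤ w n := by
    calc ‖z ^ n‖ = ‖φ (beurlingX ^ n)‖ := by rw [map_pow]
      _ ≤ _ := h2
      _ ≤ 1 * w n := mul_le_mul_of_nonneg_right h3 (hw.pos n).le
      _ = w n := one_mul _
  rw [norm_pow] at h4
  exact absurd h4 (not_le.2 hn)

end BeurlingAlgebra

/-! ### The weight `F c (n + 1)` -/

section Renewal


/-- The weight `n ↦ F c (n + 1)`. The shift makes it submultiplicative on all of `ℕ`, because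
`i + j + 1 ≤ (i + 1) * (j + 1)`. -/
noncomputable def weight (c : ℝ) (n : ℕ) : ℝ := F c (n + 1)

theorem F_natCast_mono {c : ℝ} (hc : 0 < c) {m n : ℕ} (h : m ≤ n) : F c m ≤ F c n := by
  unfold F
  rcases Nat.eq_zero_or_pos m with rfl | hm
  · simp only [Nat.cast_zero, Real.log_zero, Real.sqrt_zero, mul_zero, Real.exp_zero]
    exact Real.one_le_exp (by positivity)
  · have : (0 : ℝ) < m := by exact_mod_cast hm
    gcongr

theorem weight_eq (c : ℝ) (n : ℕ) : weight c n = F c ((n + 1 : ℕ) : ℝ) := by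
  simp [weight]

theorem weight_mono {c : ℝ} (hc : 0 < c) : Monotone (weight c) := fun m n h => by
  rw [weight_eq, weight_eq]
  exact F_natCast_mono hc (by omega)

theorem F_le_weight {c : ℝ} (hc : 0 < c) (n : ℕ) : F c n ≤ weight c n := by
  rw [weight_eq]
  exact F_natCast_mono hc (by omega)

theorem isBeurlingWeight_weight {c : ℝ} (hc : 0 < c) : IsBeurlingWeight (weight c) where
  zero := by simp [weight, F]
  one_le n := Real.one_le_exp (by positivity)
  submul i j := by
    unfold weight F
    rw [← Real.exp_add, ← mul_add]
    have hi : (0 : ℝ) ≤ i := Nat.cast_nonneg i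
    have hj : (0 : ℝ) ≤ j := Nat.cast_nonneg j
    have hli : 0 ≤ Real.log ((i : ℝ) + 1) := Real.log_nonneg (by linarith)
    have hlj : 0 ≤ Real.log ((j : ℝ) + 1) := Real.log_nonneg (by linarith)
    gcongr
    refine Real.sqrt_le_iff.2 ⟨by positivity, ?_⟩
    have h1 : Real.log (((i + j : ℕ) : ℝ) + 1) ≤
        Real.log ((i : ℝ) + 1) + Real.log ((j : ℝ) + 1) := by
      rw [← Real.log_mul (by positivity) (by positivity)]
      refine Real.log_le_log (by positivity) ?_
      push_cast
      nlinarith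
    nlinarith [Real.sq_sqrt hli, Real.sq_sqrt hlj, Real.sqrt_nonneg (Real.log ((i : ℝ) + 1)),
      Real.sqrt_nonneg (Real.log ((j : ℝ) + 1)),
      mul_nonneg (Real.sqrt_nonneg (Real.log ((i : ℝ) + 1)))
        (Real.sqrt_nonneg (Real.log ((j : ℝ) + 1)))]
  subexp r hr := by
    have hr' : 0 < Real.log r := Real.log_pos hr
    have h1 := Real.isLittleO_log_id_atTop.bound (show 0 < Real.log r / (2 * c) by positivity)
    have h2 : Filter.Tendsto (fun n : ℕ => (n : ℝ) + 1) Filter.atTop Filter.atTop :=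
      Filter.tendsto_atTop_add_const_right _ _ tendsto_natCast_atTop_atTop
    have h3 := tendsto_natCast_atTop_atTop.eventually_gt_atTop ((2 * c + Real.log r) / Real.log r)
    obtain ⟨n, hn1, hn2⟩ := ((h2.eventually h1).and h3).exists
    refine ⟨n, ?_⟩
    rw [div_lt_iff₀ hr'] at hn2
    have hn : (0 : ℝ) ≤ n := Nat.cast_nonneg n
    have hl : 0 ≤ Real.log ((n : ℝ) + 1) := Real.log_nonneg (by linarith)
    rw [Real.norm_of_nonneg hl, id, Real.norm_of_nonneg (by positivity)] at hn1
    have hs : Real.sqrt (Real.log ((n : ℝ) + 1)) ≤ 1 + Real.log ((n : ℝ) + 1) :=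
      Real.sqrt_le_iff.2 ⟨by positivity, by nlinarith⟩
    have h4 : c * Real.log ((n : ℝ) + 1) ≤ Real.log r / 2 * (n + 1) := by
      calc c * Real.log ((n : ℝ) + 1) ≤ c * (Real.log r / (2 * c) * (n + 1)) := by gcongr
        _ = _ := by field_simp
    calc weight c n ≤ Real.exp (c * (1 + Real.log ((n : ℝ) + 1))) := by
          unfold weight F; gcongr
      _ < Real.exp (n * Real.log r) := by
          rw [Real.exp_lt_exp]; nlinarith
      _ = r ^ n := by rw [mul_comm, Real.exp_mul, Real.exp_log (by linarith), Real.rpow_natCast]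

/-! ### The renewal theorem with a rate -/

/-- The tail `∑_{i > k} p i`. -/
noncomputable def tailSum (p : ℕ → ℝ) (k : ℕ) : ℝ := ∑' i, p (k + 1 + i)

/-- An aperiodic probability vector `p` on `{1, 2, …}`. -/
structure IsAperiodicLaw (p : ℕ → ℝ) : Prop where
  nonneg : ∀ k, 0 ≤ p k
  zero : p 0 = 0
  hasSum : HasSum p 1
  aperiodic : ∀ d : ℕ, (∀ k, 0 < p k → d ∣ k) → d = 1

variable {p : ℕ → ℝ}

theorem IsAperiodicLaw.summable_shift (hp : IsAperiodicLaw p) (k : ℕ) :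
    Summable fun i => p (k + i) := by
  simpa only [add_comm k] using (summable_nat_add_iff k).2 hp.hasSum.summable

theorem IsAperiodicLaw.tailSum_nonneg (hp : IsAperiodicLaw p) (k : ℕ) : 0 ≤ tailSum p k :=
  tsum_nonneg fun _ => hp.nonneg _

theorem IsAperiodicLaw.tailSum_succ (hp : IsAperiodicLaw p) (k : ℕ) :
    tailSum p k = p (k + 1) + tailSum p (k + 1) := by
  unfold tailSum
  rw [(hp.summable_shift (k + 1)).tsum_eq_zero_add]
  congr 1
  exact tsum_congr fun i => by congr 1; omega

theorem IsAperiodicLaw.tailSum_zero (hp : IsAperiodicLaw p) : tailSum p 0 = 1 := by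
  have := hp.hasSum.summable.tsum_eq_zero_add
  rw [hp.hasSum.tsum_eq, hp.zero, zero_add] at this
  rw [this, tailSum]
  exact tsum_congr fun i => by congr 1; omega

theorem IsAperiodicLaw.hasSum_succ (hp : IsAperiodicLaw p) : HasSum (fun k => p (k + 1)) 1 := by
  have := (hasSum_nat_add_iff' 1).2 hp.hasSum
  simpa [hp.zero] using this

/-- The factorisation `1 - ∑ pₖ Xᵏ = (1 - X) ∑ tₖ Xᵏ`, with `t` the tails of `p`. -/
theorem IsAperiodicLaw.one_sub_X_mul_tail (hp : IsAperiodicLaw p) :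
    (1 - PowerSeries.X) * PowerSeries.mk (fun k => (tailSum p k : ℂ)) =
      1 - PowerSeries.mk (fun k => (p k : ℂ)) := by
  ext n
  rcases n with _ | n
  · simp [sub_mul, hp.zero, hp.tailSum_zero]
  · simp [sub_mul, PowerSeries.coeff_succ_X_mul, PowerSeries.coeff_one, hp.tailSum_succ n]

/-- Aperiodicity: the generating function of the tails has no zero in the closed unit disc. -/
theorem IsAperiodicLaw.tail_ne_zero (hp : IsAperiodicLaw p) (ht : Summable (tailSum p)) (z : ℂ)
    (hz : ‖z‖ ≤ 1) : ∑' n, (tailSum p n : ℂ) * z ^ n ≠ 0 := by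
  intro h0
  have hpow : ∀ n, ‖z ^ n‖ ≤ 1 := fun n => by
    rw [norm_pow]; exact pow_le_one₀ (norm_nonneg _) hz
  have hsum : Summable fun n => (tailSum p n : ℂ) * z ^ n := by
    refine Summable.of_norm_bounded ht fun n => ?_
    rw [norm_mul, Complex.norm_real, Real.norm_of_nonneg (hp.tailSum_nonneg n)]
    exact mul_le_of_le_one_right (hp.tailSum_nonneg n) (hpow n)
  have hs0 : HasSum (fun n => (tailSum p n : ℂ) * z ^ n) 0 := h0 ▸ hsum.hasSum
  have hs1 : HasSum (fun n => (tailSum p n : ℂ) * z ^ (n + 1)) 0 := by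
    simpa [pow_succ, mul_assoc] using hs0.mul_right z
  have hs2 : HasSum (fun n => (tailSum p (n + 1) : ℂ) * z ^ (n + 1)) (-1) := by
    have := (hasSum_nat_add_iff' 1).2 hs0
    simpa [hp.tailSum_zero] using this
  have hs3 : HasSum (fun n => (p (n + 1) : ℂ) * z ^ (n + 1)) 1 := by
    have := hs1.sub hs2
    simp only [sub_neg_eq_add, zero_add] at this
    refine this.congr_fun ?_ |> id
    intro n
    rw [hp.tailSum_succ n]; push_cast; ring
  -- real parts: a convex combination of points of the disc equals `1` only if all of them do
  have hs4 : HasSum (fun n => p (n + 1) * (1 - (z ^ (n + 1)).re)) 0 := by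
    have := hp.hasSum_succ.sub (Complex.hasSum_re hs3)
    simp only [Complex.re_ofReal_mul, Complex.one_re, sub_self] at this
    simpa [mul_sub] using this
  have hre : ∀ n, (z ^ n).re ≤ 1 := fun n => (Complex.re_le_norm _).trans (hpow n)
  have hs5 : (fun n => p (n + 1) * (1 - (z ^ (n + 1)).re)) = 0 :=
    (hasSum_zero_iff_of_nonneg fun n =>
      mul_nonneg (hp.nonneg _) (sub_nonneg.2 (hre _))).1 hs4
  have hone : ∀ k, 0 < p k → z ^ k = 1 := by
    intro k hk
    rcases k with _ | k
    · simp
    have h1 := congrFun hs5 k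
    simp only [Pi.zero_apply, mul_eq_zero, hk.ne', false_or] at h1
    have h2 : (z ^ (k + 1)).re = 1 := by linarith
    have h3 := hpow (k + 1)
    rw [← sq_le_one_iff₀ (norm_nonneg _), ← Complex.normSq_eq_norm_sq, Complex.normSq_apply,
      h2] at h3
    exact Complex.ext h2 (by simpa using (by nlinarith : (z ^ (k + 1)).im = 0))
  have hord : orderOf z = 1 := hp.aperiodic _ fun k hk => orderOf_dvd_of_pow_eq_one (hone k hk)
  rw [orderOf_eq_one_iff] at hord
  subst hord
  have h1 : ∑' n, tailSum p n = 0 := by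
    have := hs0
    simp only [one_pow, mul_one] at this
    exact (Complex.hasSum_ofReal.1 (by simpa using this)).tsum_eq
  have h2 := ht.le_tsum 0 fun n _ => hp.tailSum_nonneg n
  rw [h1, hp.tailSum_zero] at h2
  linarith

/-- The tail of the coefficient sum beyond `n` gains the factor `1 / w n`. -/
theorem beurling_tail_le {w : ℕ → ℝ} {hw : IsBeurlingWeight w} (hmono : Monotone w)
    (H : beurling w hw) (n : ℕ) :
    ‖∑' k, PowerSeries.coeff (k + (n + 1)) H.1‖ ≤ ‖H‖ / w n := by
  have hHw := mem_beurling.1 H.2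
  have hHn : Summable fun k => ‖PowerSeries.coeff k H.1‖ := hHw.of_nonneg_of_le
    (fun _ => norm_nonneg _) fun k => le_mul_of_one_le_right (norm_nonneg _) (hw.one_le k)
  have hHn' : Summable fun k => ‖PowerSeries.coeff (k + (n + 1)) H.1‖ :=
    (summable_nat_add_iff (f := fun k => ‖PowerSeries.coeff k H.1‖) (n + 1)).2 hHn
  have hHw' : Summable fun k => ‖PowerSeries.coeff (k + (n + 1)) H.1‖ * w (k + (n + 1)) :=
    (summable_nat_add_iff (f := fun k => ‖PowerSeries.coeff k H.1‖ * w k) (n + 1)).2 hHw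
  rw [le_div_iff₀ (hw.pos n), beurling_norm_eq]
  refine (mul_le_mul_of_nonneg_right (norm_tsum_le_tsum_norm hHn') (hw.pos n).le).trans ?_
  rw [← tsum_mul_right]
  refine (Summable.tsum_le_tsum (fun k => ?_) (hHn'.mul_right _) hHw').trans ?_
  · exact mul_le_mul_of_nonneg_left (hmono (by omega)) (norm_nonneg _)
  · rw [← hHw.sum_add_tsum_nat_add (n + 1)]
    exact le_add_of_nonneg_left (Finset.sum_nonneg fun k _ =>
      mul_nonneg (norm_nonneg _) (hw.pos k).le)

/-- Solutions of the renewal equation converge to the inverse of the mean, at the rate given by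
the weight. -/
theorem renewal_rate (hp : IsAperiodicLaw p) {w : ℕ → ℝ} (hw : IsBeurlingWeight w)
    (hmono : Monotone w) (htw : Summable fun k => tailSum p k * w k) :
    ∃ C : ℝ, 0 ≤ C ∧ ∀ u : ℕ → ℝ, u 0 = 1 →
      (∀ j, u (j + 1) = ∑ i ∈ Finset.range (j + 1), u i * p (j + 1 - i)) →
      ∀ n, |u n - 1 / ∑' k, tailSum p k| ≤ C / w n := by
  have ht : Summable (tailSum p) := htw.of_nonneg_of_le hp.tailSum_nonneg fun k =>
    le_mul_of_one_le_right (hp.tailSum_nonneg k) (hw.one_le k)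
  let T : beurling w hw := ⟨PowerSeries.mk fun k => (tailSum p k : ℂ), mem_beurling.2 <| by
    simpa [abs_of_nonneg (hp.tailSum_nonneg _)] using htw⟩
  have hT : IsUnit T := beurling_isUnit T fun z hz => by
    simpa [T] using hp.tail_ne_zero ht z hz
  obtain ⟨H, hH⟩ := hT.exists_left_inv
  have hH' : H.1 * T.1 = 1 := congrArg Subtype.val hH
  have hHw := mem_beurling.1 H.2
  have hHn : Summable fun n => ‖PowerSeries.coeff n H.1‖ := hHw.of_nonneg_of_le
    (fun _ => norm_nonneg _) fun k => le_mul_of_one_le_right (norm_nonneg _) (hw.one_le k)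
  -- evaluation of `H * T = 1` at the point `1`
  have hsum : (∑' n, PowerSeries.coeff n H.1) * ((∑' k, tailSum p k : ℝ) : ℂ) = 1 := by
    have h1 := tsum_mul_tsum_eq_tsum_sum_antidiagonal_of_summable_norm hHn
      (g := fun n => (tailSum p n : ℂ)) (by simpa [abs_of_nonneg (hp.tailSum_nonneg _)] using ht)
    rw [Complex.ofReal_tsum, h1]
    have h2 : ∀ n, ∑ kl ∈ Finset.HasAntidiagonal.antidiagonal n,
        PowerSeries.coeff kl.1 H.1 * (tailSum p kl.2 : ℂ) = if n = 0 then 1 else 0 := by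
      intro n
      rw [← PowerSeries.coeff_one, ← hH', PowerSeries.coeff_mul]
      simp [T]
    simp only [h2, tsum_ite_eq]
  have hm : ((∑' k, tailSum p k : ℝ) : ℂ) ≠ 0 := right_ne_zero_of_mul_eq_one hsum
  refine ⟨‖H‖, norm_nonneg _, fun u hu0 hu n => ?_⟩
  -- the renewal equation in terms of generating functions
  have hU : PowerSeries.mk (fun k => (u k : ℂ)) * (1 - PowerSeries.mk fun k => (p k : ℂ)) = 1 := by
    ext j
    rcases j with _ | j
    · simp [mul_sub, hp.zero, hu0]
    · rw [mul_sub, mul_one, map_sub, PowerSeries.coeff_mul,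
        Finset.Nat.sum_antidiagonal_eq_sum_range_succ_mk, Finset.sum_range_succ]
      simp [PowerSeries.coeff_one, hp.zero, hu j]
  -- `mk 1 = 1 / (1 - X)`, so the coefficients of `U` are the partial sums of those of `H`
  have hUH : PowerSeries.mk (fun k => (u k : ℂ)) = H.1 * PowerSeries.mk 1 := by
    rw [← hp.one_sub_X_mul_tail] at hU
    calc _ = PowerSeries.mk (fun k => (u k : ℂ)) * (H.1 * T.1) *
          (PowerSeries.mk 1 * (1 - PowerSeries.X)) := by
          rw [hH', PowerSeries.mk_one_mul_one_sub_eq_one, mul_one, mul_one]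
      _ = H.1 * PowerSeries.mk 1 * (PowerSeries.mk (fun k => (u k : ℂ)) *
          ((1 - PowerSeries.X) * T.1)) := by ring
      _ = _ := by rw [hU, mul_one]
  have hun : (u n : ℂ) = ∑ k ∈ Finset.range (n + 1), PowerSeries.coeff k H.1 := by
    have := congrArg (PowerSeries.coeff n) hUH
    rw [PowerSeries.coeff_mul, Finset.Nat.sum_antidiagonal_eq_sum_range_succ_mk] at this
    simpa using this
  -- `∑ h k = 1 / M`, so the error is a tail of this sum
  have hdiff : ((u n - 1 / ∑' k, tailSum p k : ℝ) : ℂ) =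
      -∑' k, PowerSeries.coeff (k + (n + 1)) H.1 := by
    have h1 := hHn.of_norm.sum_add_tsum_nat_add (n + 1)
    rw [← hun] at h1
    rw [← eq_div_iff hm] at hsum
    push_cast at hsum h1 ⊢
    rw [← hsum, ← h1]; ring
  rw [← Real.norm_eq_abs, ← Complex.norm_real, hdiff, norm_neg]
  exact beurling_tail_le hmono H n

end Renewal

/-! ### Paths of the renewal process -/

section Paths


/-- The path `n ↦ Zₙ` of the renewal process with delay `k` and interarrival times `s`. -/
noncomputable def path (k : ℕ) (s : ℕ → ℕ) (n : ℕ) : ℕ :=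
  renewalZ (fun _ : Unit => k) (fun i _ => s i) n ()

/-- The time shift of a path. -/
def shift (j : ℕ) (x : ℕ → ℕ) (n : ℕ) : ℕ := x (j + n)

/-- The path which starts in `k` and continues as `x`. -/
def consPath (k : ℕ) (x : ℕ → ℕ) : ℕ → ℕ
  | 0 => k
  | n + 1 => x n

theorem measurable_shift (j : ℕ) : Measurable (shift j) :=
  measurable_pi_lambda _ fun n => measurable_pi_apply (j + n)

theorem measurable_consPath (k : ℕ) : Measurable (consPath k) :=
  measurable_pi_lambda _ fun n => by
    cases n with
    | zero => exact measurable_const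
    | succ n => exact measurable_pi_apply n

theorem shift_shift (i j : ℕ) (x : ℕ → ℕ) : shift i (shift j x) = shift (j + i) x := by
  ext n; simp [shift, add_assoc]

theorem shift_zero (x : ℕ → ℕ) : shift 0 x = x := by
  ext n; simp [shift]

theorem shift_one_consPath (k : ℕ) (x : ℕ → ℕ) : shift 1 (consPath k x) = x := by
  ext n; simp [shift, add_comm 1 n, consPath]

theorem shift_succ_consPath (j k : ℕ) (x : ℕ → ℕ) : shift (j + 1) (consPath k x) = shift j x := by
  rw [add_comm, ← shift_shift, shift_one_consPath]

section Recursion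

variable {Ω : Type*}

theorem renewalX_eq (χ : Ω → ℕ) (ξs : ℕ → Ω → ℕ) (i : ℕ) (ω : Ω) :
    renewalX χ ξs i ω = renewalX (fun _ : Unit => χ ω) (fun i _ => ξs i ω) i () := by
  induction i with
  | zero => rfl
  | succ i ih => simp only [renewalX, ih]

theorem renewalZ_eq_path (χ : Ω → ℕ) (ξs : ℕ → Ω → ℕ) (ω : Ω) :
    (fun n => renewalZ χ ξs n ω) = path (χ ω) (fun i => ξs i ω) := by
  ext n
  simp only [path, renewalZ, renewalX_eq χ ξs _ ω]

/-- The renewal points, as a function of the delay and of the interarrival times. -/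
def point (k : ℕ) (s : ℕ → ℕ) (i : ℕ) : ℕ := renewalX (fun _ : Unit => k) (fun i _ => s i) i ()

theorem path_eq (k : ℕ) (s : ℕ → ℕ) (n : ℕ) :
    path k s n = sInf {j | ∃ i, n ≤ point k s i ∧ j = point k s i - n} := rfl

theorem point_succ (k : ℕ) (s : ℕ → ℕ) (i : ℕ) : point (k + 1) s i = point k s i + 1 := by
  induction i with
  | zero => rfl
  | succ i ih =>
    change point (k + 1) s i + s i = point k s i + s i + 1
    rw [ih]; omega

theorem point_zero_succ (s : ℕ → ℕ) (i : ℕ) : point 0 s (i + 1) = point (s 0) (shift 1 s) i := by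
  induction i with
  | zero => exact zero_add _
  | succ i ih =>
    change point 0 s (i + 1) + s (i + 1) = point (s 0) (shift 1 s) i + s (1 + i)
    rw [ih, add_comm 1 i]

theorem le_point (k : ℕ) (s : ℕ → ℕ) (i : ℕ) : k ≤ point k s i := by
  induction i with
  | zero => exact le_rfl
  | succ i ih => exact ih.trans (Nat.le_add_right _ _)

theorem path_zero (k : ℕ) (s : ℕ → ℕ) : path k s 0 = k := by
  rw [path_eq]
  refine le_antisymm (Nat.sInf_le ⟨0, Nat.zero_le _, rfl⟩)
    (le_csInf ⟨k, 0, Nat.zero_le _, rfl⟩ ?_)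
  rintro _ ⟨i, -, rfl⟩
  exact le_point k s i

theorem path_succ (k : ℕ) (s : ℕ → ℕ) : path (k + 1) s = consPath (k + 1) (path k s) := by
  ext n
  rcases n with _ | n
  · exact path_zero _ _
  · simp only [consPath, path_eq, point_succ, add_le_add_iff_right, Nat.add_sub_add_right]

/-- At a renewal the process restarts: with zero delay and first interarrival time `l + 1`, the path
after time `0` has delay `l`. -/
theorem path_renewal (s : ℕ → ℕ) (l : ℕ) (h : s 0 = l + 1) :
    path 0 s = consPath 0 (path l (shift 1 s)) := by
  ext n
  rcases n with _ | n
  · exact path_zero _ _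
  · simp only [consPath, path_eq]
    congr 1
    ext j
    constructor
    · rintro ⟨i, hi, rfl⟩
      rcases i with _ | i
      · exact absurd hi (by simp [point, renewalX])
      · rw [point_zero_succ, h, point_succ] at hi ⊢
        exact ⟨i, by omega, by omega⟩
    · rintro ⟨i, hi, rfl⟩
      refine ⟨i + 1, ?_, ?_⟩ <;> rw [point_zero_succ, h, point_succ] <;> omega

theorem measurable_point (k i : ℕ) : Measurable fun s => point k s i := by
  induction i with
  | zero => exact measurable_const
  | succ i ih => exact ih.add (measurable_pi_apply i)

theorem measurable_path (k : ℕ) : Measurable (path k) := by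
  refine measurable_pi_lambda _ fun n => ?_
  have hmem : ∀ j, MeasurableSet {s | ∃ i, n ≤ point k s i ∧ j = point k s i - n} := by
    intro j
    rw [Set.ofPred_exists]
    refine MeasurableSet.iUnion fun i => ?_
    exact (measurable_point k i) (MeasurableSet.of_discrete (s := {x | n ≤ x ∧ j = x - n}))
  refine measurable_of_Iio fun a => ?_
  have : (fun s => path k s n) ⁻¹' Set.Iio a =
      {s | ∃ j, j < a ∧ ∃ i, n ≤ point k s i ∧ j = point k s i - n} ∪
        {s | (∀ j, ¬ ∃ i, n ≤ point k s i ∧ j = point k s i - n) ∧ 0 < a} := by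
    ext s
    simp only [Set.mem_preimage, Set.mem_Iio, path_eq, Set.mem_union, Set.mem_ofPred_eq]
    constructor
    · intro h
      by_cases he : {j | ∃ i, n ≤ point k s i ∧ j = point k s i - n}.Nonempty
      · exact Or.inl ⟨_, h, Nat.sInf_mem he⟩
      · exact Or.inr ⟨fun j hj => he ⟨j, hj⟩, by omega⟩
    · rintro (⟨j, hj, hi⟩ | ⟨h, ha⟩)
      · exact (Nat.sInf_le hi).trans_lt hj
      -- the infimum of the empty set is `0`
      · rw [Set.eq_empty_of_forall_notMem (s := {j | ∃ i, n ≤ point k s i ∧ j = point k s i - n}) h]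
        simpa using ha
  rw [this]
  refine MeasurableSet.union ?_ ?_
  · rw [Set.ofPred_exists]
    refine MeasurableSet.iUnion fun j => ?_
    rw [Set.ofPred_and]
    exact (MeasurableSet.const _).inter (hmem j)
  · rw [Set.ofPred_and, Set.ofPred_forall]
    refine MeasurableSet.inter ?_ (MeasurableSet.const _)
    exact MeasurableSet.iInter fun j => (hmem j).compl

end Recursion

/-! ### The Markov property -/

variable {κ : Measure ℕ}

variable (κ) in
/-- The law of the renewal process with deterministic delay `k` and interarrival law `κ`. -/
noncomputable def pathLaw (k : ℕ) : Measure (ℕ → ℕ) :=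
  (Measure.infinitePi fun _ : ℕ => κ).map (path k)

theorem measurableSet_coord (m j : ℕ) : MeasurableSet {x : ℕ → ℕ | x m = j} :=
  measurableSet_eq_fun (measurable_pi_apply m) measurable_const

theorem pathLaw_start (k : ℕ) : ∀ᵐ x ∂(pathLaw κ k), x 0 = k := by
  rw [pathLaw, ae_map_iff (measurable_path k).aemeasurable
    (measurableSet_coord 0 k)]
  exact Filter.Eventually.of_forall fun s => path_zero k s

variable [IsProbabilityMeasure κ]

/-- The law of an i.i.d. sequence splits into its first entry and the remaining sequence. -/
theorem infinitePi_map_head_tail :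
    (Measure.infinitePi fun _ : ℕ => κ).map (fun s => (s 0, shift 1 s)) =
      κ.prod (Measure.infinitePi fun _ : ℕ => κ) := by
  have hind : iIndepFun (fun (i : ℕ) (s : ℕ → ℕ) => s i) (Measure.infinitePi fun _ : ℕ => κ) :=
    iIndepFun_infinitePi (X := fun _ x => x) fun _ => measurable_id
  have h01 : IndepFun (fun s : ℕ → ℕ => s 0) (shift 1) (Measure.infinitePi fun _ : ℕ => κ) := by
    have h := indep_iSup_of_disjoint (fun i => (measurable_pi_apply i).comap_le) hind
      (S := {0}) (T := {i | 1 ≤ i}) (by simp)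
    refine indep_of_indep_of_le_right (indep_of_indep_of_le_left h ?_) ?_
    · exact le_iSup₂_of_le 0 rfl le_rfl
    · refine (MeasurableSpace.comap_process_pi fun (n : ℕ) (s : ℕ → ℕ) => s (1 + n)).trans_le ?_
      exact iSup_le fun n => le_iSup₂_of_le (1 + n) (Nat.le_add_right _ _) le_rfl
  rw [(indepFun_iff_map_prod_eq_prod_map_map (measurable_pi_apply 0).aemeasurable
    (measurable_shift 1).aemeasurable).1 h01, Measure.infinitePi_map_eval]
  congr 1
  exact Measure.map_infinitePi_infinitePi_of_inj (P := fun _ : ℕ => κ)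
    (f := fun n => 1 + n) (add_right_injective 1)

instance (k : ℕ) : IsProbabilityMeasure (pathLaw κ k) :=
  Measure.isProbabilityMeasure_map (measurable_path k).aemeasurable

variable (κ) in
/-- The transition probabilities of the Markov chain `Z`: it moves down by one until it reaches
`0`, from where it jumps to `l` with the probability of an interarrival time `l + 1`. -/
noncomputable def trans : ℕ → ℕ → ℝ≥0∞
  | 0, l => κ {l + 1}
  | k + 1, l => if l = k then 1 else 0

/-- The first step decomposition of the path law. -/
theorem pathLaw_step (hκ : κ {0} = 0) (k : ℕ) {S : Set (ℕ → ℕ)} (hS : MeasurableSet S) :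
    pathLaw κ k S = ∑' l, trans κ k l * pathLaw κ l (consPath k ⁻¹' S) := by
  rcases k with _ | k
  · rw [pathLaw, Measure.map_apply (measurable_path 0) hS]
    have hD : ∀ l, MeasurableSet (consPath 0 ∘ path l ⁻¹' S) := fun l =>
      (measurable_consPath 0).comp (measurable_path l) hS
    -- split according to the first interarrival time, which is positive almost surely
    have hsplit : path 0 ⁻¹' S =ᵐ[Measure.infinitePi fun _ : ℕ => κ]
        ⋃ l, (fun s : ℕ → ℕ => (s 0, shift 1 s)) ⁻¹'
          ({l + 1} ×ˢ (consPath 0 ∘ path l ⁻¹' S)) := by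
      have h0 : ∀ᵐ s ∂(Measure.infinitePi fun _ : ℕ => κ), s 0 ≠ 0 := by
        have : (Measure.infinitePi fun _ : ℕ => κ).map (fun s => s 0) {0} = 0 := by
          rw [Measure.infinitePi_map_eval, hκ]
        rw [Measure.map_apply (measurable_pi_apply 0) (measurableSet_singleton 0)] at this
        exact measure_eq_zero_iff_ae_notMem.1 this
      rw [Filter.eventuallyEq_set]
      filter_upwards [h0] with s hs
      obtain ⟨l, hl⟩ := Nat.exists_eq_succ_of_ne_zero hs
      simp only [Set.mem_preimage, Set.mem_iUnion, Set.mem_prod, Set.mem_singleton_iff,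
        Function.comp_apply, path_renewal s l hl]
      constructor
      · intro h; exact ⟨l, hl, h⟩
      · rintro ⟨l', hl', h⟩
        have : l' = l := by omega
        rwa [this] at h
    rw [measure_congr hsplit, measure_iUnion]
    · refine tsum_congr fun l => ?_
      have hm : Measurable fun s : ℕ → ℕ => (s 0, shift 1 s) :=
        (measurable_pi_apply 0).prodMk (measurable_shift 1)
      rw [← Measure.map_apply hm ((measurableSet_singleton _).prod (hD l)),
        infinitePi_map_head_tail, Measure.prod_prod, pathLaw,
        Measure.map_apply (measurable_path l) (measurable_consPath 0 hS)]
      rfl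
    · intro i j hij
      rw [Function.onFun, Set.disjoint_left]
      rintro s ⟨hi, -⟩ ⟨hj, -⟩
      simp only [Set.mem_singleton_iff] at hi hj
      omega
    · intro l
      exact ((measurable_pi_apply 0).prodMk (measurable_shift 1))
        ((measurableSet_singleton _).prod (hD l))
  · rw [tsum_eq_single k (fun l hl => by simp [trans, hl])]
    have : path (k + 1) = consPath (k + 1) ∘ path k := funext fun s => path_succ k s
    rw [pathLaw, this, ← Measure.map_map (measurable_consPath _) (measurable_path k),
      Measure.map_apply (measurable_consPath _) hS]
    simp [trans, pathLaw]

/-- The set `A` of paths depends on the coordinates `0, …, m` only. -/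
def DependsUpTo (m : ℕ) (A : Set (ℕ → ℕ)) : Prop :=
  ∀ x y : ℕ → ℕ, (∀ i ≤ m, x i = y i) → x ∈ A → y ∈ A

/-- The Markov property at time `m`: given the past up to time `m` and `Z m = j`, the future is
distributed as the process with delay `j`. -/
theorem pathLaw_markov (hκ : κ {0} = 0) {S : Set (ℕ → ℕ)} (hS : MeasurableSet S) (m : ℕ) :
    ∀ (k : ℕ) (A : Set (ℕ → ℕ)), MeasurableSet A → DependsUpTo m A →
      pathLaw κ k (A ∩ shift m ⁻¹' S) =
        ∑' j, pathLaw κ k (A ∩ {x | x m = j}) * pathLaw κ j S := by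
  induction m with
  | zero =>
    intro k A _ hA
    have hmem : ∀ᵐ x ∂(pathLaw κ k), (x ∈ A ↔ (fun _ => k) ∈ A) := by
      filter_upwards [pathLaw_start k] with x hx
      constructor <;> refine hA _ _ fun i hi => ?_ <;> rw [Nat.le_zero.1 hi, hx]
    rw [tsum_eq_single k]
    · by_cases h : (fun _ => k) ∈ A
      · have h1 : (A ∩ shift 0 ⁻¹' S : Set _) =ᵐ[pathLaw κ k] S := by
          rw [Filter.eventuallyEq_set]
          filter_upwards [hmem] with x hx
          simp [hx, h, shift_zero]
        have h2 : (A ∩ {x | x 0 = k} : Set _) =ᵐ[pathLaw κ k] Set.univ := by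
          rw [Filter.eventuallyEq_set]
          filter_upwards [hmem, pathLaw_start k] with x hx hx0
          simp [hx, h, hx0]
        rw [measure_congr h1, measure_congr h2, measure_univ, one_mul]
      · have h1 : pathLaw κ k A = 0 := by
          rw [measure_eq_zero_iff_ae_notMem]
          filter_upwards [hmem] with x hx
          simp [hx, h]
        rw [measure_inter_null_of_null_left _ h1, measure_inter_null_of_null_left _ h1, zero_mul]
    · intro j hj
      have h1 : pathLaw κ k {x | x 0 = j} = 0 := by
        rw [measure_eq_zero_iff_ae_notMem]
        filter_upwards [pathLaw_start k] with x hx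
        simp [hx, hj.symm]
      rw [measure_inter_null_of_null_right _ h1, zero_mul]
  | succ m ih =>
    intro k A hAm hA
    rw [pathLaw_step hκ k (hAm.inter (measurable_shift _ hS))]
    have hA' : DependsUpTo m (consPath k ⁻¹' A) := fun x y hxy hx => by
      refine hA _ _ (fun i hi => ?_) hx
      rcases i with _ | i
      · rfl
      · exact hxy i (by omega)
    have h1 : ∀ l, pathLaw κ l (consPath k ⁻¹' (A ∩ shift (m + 1) ⁻¹' S)) =
        ∑' j, pathLaw κ l (consPath k ⁻¹' A ∩ {x | x m = j}) * pathLaw κ j S := by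
      intro l
      rw [← ih l _ (measurable_consPath k hAm) hA', Set.preimage_inter]
      congr 2
      ext x
      simp [shift_succ_consPath]
    simp only [h1, ← ENNReal.tsum_mul_left]
    rw [ENNReal.tsum_comm]
    refine tsum_congr fun j => ?_
    rw [pathLaw_step hκ k (hAm.inter (measurableSet_coord (m + 1) j)), ← ENNReal.tsum_mul_right]
    exact tsum_congr fun l => (mul_assoc _ _ _).symm

end Paths

/-! ### Convergence to stationarity in total variation -/

section TotalVariation


section Stationary

variable {κ : Measure ℕ} [IsProbabilityMeasure κ]

/-- Started from a stationary distribution `q` of the chain, the law of the path is invariant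
under time shifts. -/
theorem tsum_pathLaw_shift (hκ : κ {0} = 0) {q : ℕ → ℝ≥0∞}
    (hq : ∀ l, ∑' k, q k * trans κ k l = q l) (j : ℕ) :
    ∀ {S : Set (ℕ → ℕ)}, MeasurableSet S →
      ∑' k, q k * pathLaw κ k (shift j ⁻¹' S) = ∑' k, q k * pathLaw κ k S := by
  induction j with
  | zero =>
    intro S _
    have : shift 0 ⁻¹' S = S := by ext x; simp [shift_zero]
    rw [this]
  | succ j ih =>
    intro S hS
    have h1 : ∀ k, consPath k ⁻¹' (shift (j + 1) ⁻¹' S) = shift j ⁻¹' S := by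
      intro k
      ext x
      simp [shift_succ_consPath]
    rw [← ih hS]
    simp only [pathLaw_step hκ _ (measurable_shift (j + 1) hS), h1,
      ← ENNReal.tsum_mul_left]
    rw [ENNReal.tsum_comm]
    refine tsum_congr fun l => ?_
    simp only [← mul_assoc]
    rw [ENNReal.tsum_mul_right, hq l]

omit [IsProbabilityMeasure κ] in
theorem tsum_mul_trans (q : ℕ → ℝ≥0∞) (l : ℕ) :
    ∑' k, q k * trans κ k l = q 0 * κ {l + 1} + q (l + 1) := by
  rw [tsum_eq_zero_add' ENNReal.summable, tsum_eq_single l]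
  · simp [trans]
  · intro k hk
    simp [trans, hk.symm]

theorem pathLaw_coord_one (hκ : κ {0} = 0) (k l : ℕ) :
    pathLaw κ k {x | x 1 = l} = trans κ k l := by
  have h0 : ∀ j, pathLaw κ j {x | x 0 = l} = if j = l then 1 else 0 := by
    intro j
    split_ifs with h
    · rw [← prob_compl_eq_zero_iff (measurableSet_coord 0 l), measure_eq_zero_iff_ae_notMem]
      filter_upwards [pathLaw_start j] with x hx
      simp [hx, h]
    · rw [measure_eq_zero_iff_ae_notMem]
      filter_upwards [pathLaw_start j] with x hx
      simp [hx, h]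
  rw [pathLaw_step hκ k (measurableSet_coord 1 l)]
  have h1 : consPath k ⁻¹' {x | x 1 = l} = {x | x 0 = l} := rfl
  simp only [h1, h0]
  rw [tsum_eq_single l (fun j hj => by simp [hj])]
  simp

theorem pathLaw_coord_succ (hκ : κ {0} = 0) (j k : ℕ) :
    pathLaw κ 0 {x | x (j + 1) = k} =
      pathLaw κ 0 {x | x j = 0} * κ {k + 1} + pathLaw κ 0 {x | x j = k + 1} := by
  have h := pathLaw_markov hκ (measurableSet_coord 1 k) j 0 Set.univ MeasurableSet.univ
    (fun _ _ _ _ => trivial)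
  simp only [Set.univ_inter, pathLaw_coord_one hκ] at h
  rw [tsum_mul_trans (fun i => pathLaw κ 0 {x | x j = i})] at h
  exact h

/-- The law of `Z_{j+1}` with zero delay, decomposed at the last renewal up to time `j`. -/
theorem pathLaw_real_coord_succ (hκ : κ {0} = 0) (j : ℕ) : ∀ k,
    (pathLaw κ 0).real {x | x (j + 1) = k} =
      ∑ i ∈ Finset.range (j + 1),
        (pathLaw κ 0).real {x | x i = 0} * κ.real {j + 1 - i + k} := by
  have hstep : ∀ j k, (pathLaw κ 0).real {x | x (j + 1) = k} =
      (pathLaw κ 0).real {x | x j = 0} * κ.real {k + 1} +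
        (pathLaw κ 0).real {x | x j = k + 1} := by
    intro j k
    simp only [measureReal_def]
    rw [pathLaw_coord_succ hκ, ENNReal.toReal_add (by finiteness) (by finiteness),
      ENNReal.toReal_mul]
  induction j with
  | zero =>
    intro k
    have h0 : (pathLaw κ 0).real {x | x 0 = k + 1} = 0 := by
      rw [measureReal_def, measure_eq_zero_iff_ae_notMem.2, ENNReal.toReal_zero]
      filter_upwards [pathLaw_start 0] with x hx
      simp [hx]
    rw [hstep, h0]
    simp [add_comm]
  | succ j ih =>
    intro k
    rw [hstep, ih (k + 1), Finset.sum_range_succ _ (j + 1), add_comm]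
    congr 1
    · refine Finset.sum_congr rfl fun i hi => ?_
      rw [Finset.mem_range] at hi
      congr 3
      omega
    · congr 3
      omega

theorem pathLaw_real_coord_zero : (pathLaw κ 0).real {x | x 0 = 0} = 1 := by
  rw [measureReal_def, ENNReal.toReal_eq_one_iff,
    ← prob_compl_eq_zero_iff (measurableSet_coord 0 0), measure_eq_zero_iff_ae_notMem]
  filter_upwards [pathLaw_start 0] with x hx
  simp [hx]

end Stationary

section Rate

variable {p : ℕ → ℝ}

/-- The stationary weights, decomposed in the same way as the law of `Z n` with zero delay. -/
theorem IsAperiodicLaw.tailSum_split (hp : IsAperiodicLaw p) (k n : ℕ) :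
    tailSum p k = ∑ i ∈ Finset.range n, p (n - i + k) + tailSum p (k + n) := by
  induction n with
  | zero => simp
  | succ n ih =>
    rw [ih, Finset.sum_range_succ', hp.tailSum_succ (k + n), ← add_assoc]
    congr 2
    · exact Finset.sum_congr rfl fun i _ => by congr 1; omega
    · congr 1; omega

theorem IsAperiodicLaw.tsum_tailSum_add_le (hp : IsAperiodicLaw p) {w : ℕ → ℝ}
    (hw : IsBeurlingWeight w) (hmono : Monotone w) (htw : Summable fun k => tailSum p k * w k)
    (n : ℕ) :
    ∑' k, tailSum p (k + n) ≤ (∑' k, tailSum p k * w k) / w n := by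
  have ht : Summable (tailSum p) := htw.of_nonneg_of_le hp.tailSum_nonneg fun k =>
    le_mul_of_one_le_right (hp.tailSum_nonneg k) (hw.one_le k)
  have hnn : ∀ k, 0 ≤ tailSum p k * w k := fun k => mul_nonneg (hp.tailSum_nonneg k) (hw.pos k).le
  rw [le_div_iff₀ (hw.pos n), ← tsum_mul_right, ← htw.sum_add_tsum_nat_add n]
  refine le_add_of_nonneg_of_le (Finset.sum_nonneg fun k _ => hnn k) ?_
  exact Summable.tsum_le_tsum
    (fun k => mul_le_mul_of_nonneg_left (hmono (by omega)) (hp.tailSum_nonneg _))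
    (((summable_nat_add_iff n).2 ht).mul_right _)
    ((summable_nat_add_iff (f := fun k => tailSum p k * w k) n).2 htw)

/-- The weighted convolution estimate behind the rate: a sequence bounded by `C / w`, convolved
with a `w`-summable one, is again bounded by a multiple of `1 / w`. -/
theorem IsAperiodicLaw.conv_tail_le (hp : IsAperiodicLaw p) {w : ℕ → ℝ}
    (hw : IsBeurlingWeight w) (htw : Summable fun k => tailSum p k * w k)
    {C : ℝ} (hC : 0 ≤ C) {v : ℕ → ℝ} (hv : ∀ n, v n ≤ C / w n) (j : ℕ) :
    ∑ i ∈ Finset.range (j + 1), v i * tailSum p (j - i) ≤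
      C * w 1 * (∑' k, tailSum p k * w k) / w (j + 1) := by
  have hnn : ∀ k, 0 ≤ tailSum p k * w k := fun k => mul_nonneg (hp.tailSum_nonneg k) (hw.pos k).le
  have hterm : ∀ i ∈ Finset.range (j + 1), v i * tailSum p (j - i) ≤
      C * w 1 / w (j + 1) * (tailSum p (j - i) * w (j - i)) := by
    intro i hi
    rw [Finset.mem_range] at hi
    have h1 : w (j + 1) ≤ w i * (w (j - i) * w 1) := by
      calc w (j + 1) = w (i + ((j - i) + 1)) := by congr 1; omega
        _ ≤ w i * w ((j - i) + 1) := hw.submul _ _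
        _ ≤ _ := mul_le_mul_of_nonneg_left (hw.submul _ _) (hw.pos i).le
    have h2 : C / w i ≤ C * w 1 / w (j + 1) * w (j - i) := by
      rw [div_mul_eq_mul_div, div_le_div_iff₀ (hw.pos _) (hw.pos _)]
      calc C * w (j + 1) ≤ C * (w i * (w (j - i) * w 1)) := mul_le_mul_of_nonneg_left h1 hC
        _ = _ := by ring
    calc v i * tailSum p (j - i) ≤ C * w 1 / w (j + 1) * w (j - i) * tailSum p (j - i) :=
          mul_le_mul_of_nonneg_right ((hv i).trans h2) (hp.tailSum_nonneg _)
      _ = _ := by ring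
  refine (Finset.sum_le_sum hterm).trans ?_
  rw [← Finset.mul_sum, mul_div_right_comm (C * w 1)]
  refine mul_le_mul_of_nonneg_left ?_ (div_nonneg (mul_nonneg hC (hw.pos 1).le) (hw.pos _).le)
  have h3 := Finset.sum_flip (n := j) (fun i => tailSum p i * w i)
  rw [h3]
  exact htw.sum_le_tsum _ fun k _ => hnn k

end Rate

variable {κ : Measure ℕ} [IsProbabilityMeasure κ]

/-- The stationary distribution of the chain `Z`, the normalised tails of `κ`. -/
noncomputable def statWeight (κ : Measure ℕ) (k : ℕ) : ℝ :=
  1 / (∑' i, tailSum (fun j => κ.real {j}) i) * tailSum (fun j => κ.real {j}) k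

theorem statWeight_stationary (hp : IsAperiodicLaw fun j => κ.real {j}) (l : ℕ) :
    ∑' k, ENNReal.ofReal (statWeight κ k) * trans κ k l = ENNReal.ofReal (statWeight κ l) := by
  have hm : 0 ≤ 1 / (∑' i, tailSum (fun j => κ.real {j}) i) :=
    one_div_nonneg.2 (tsum_nonneg hp.tailSum_nonneg)
  rw [tsum_mul_trans, ← ofReal_measureReal, ← ENNReal.ofReal_mul, ← ENNReal.ofReal_add]
  · congr 1
    rw [statWeight, statWeight, statWeight, hp.tailSum_zero, hp.tailSum_succ l]
    ring
  all_goals first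
    | exact mul_nonneg hm (hp.tailSum_nonneg _)
    | exact mul_nonneg (mul_nonneg hm (hp.tailSum_nonneg _)) measureReal_nonneg

/-- The total variation distance at time `j + 1` between the zero-delay chain and its stationary
distribution. Both are convolutions with `p`, of `u` and of the constant `1 / M` respectively, up to
a stationary tail. -/
theorem tsum_abs_coord_sub_le (hp : IsAperiodicLaw fun j => κ.real {j}) {w : ℕ → ℝ}
    (hw : IsBeurlingWeight w) (hmono : Monotone w)
    (htw : Summable fun k => tailSum (fun j => κ.real {j}) k * w k) :
    ∃ C : ℝ, 0 ≤ C ∧ ∀ j, ∑' k, ENNReal.ofReal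
      |(pathLaw κ 0).real {x | x (j + 1) = k} - statWeight κ k| ≤
        ENNReal.ofReal (C / w (j + 1)) := by
  set p : ℕ → ℝ := fun j => κ.real {j} with hp_def
  have hκ : κ {0} = 0 := (measureReal_eq_zero_iff (by finiteness)).1 hp.zero
  have ht : Summable (tailSum p) := htw.of_nonneg_of_le hp.tailSum_nonneg fun k =>
    le_mul_of_one_le_right (hp.tailSum_nonneg k) (hw.one_le k)
  obtain ⟨C, hC, hrate⟩ := renewal_rate hp hw hmono htw
  set r := 1 / ∑' k, tailSum p k with hr
  have hr0 : 0 ≤ r := one_div_nonneg.2 (tsum_nonneg hp.tailSum_nonneg)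
  set W := ∑' k, tailSum p k * w k with hW
  have hW0 : 0 ≤ W := tsum_nonneg fun k => mul_nonneg (hp.tailSum_nonneg k) (hw.pos k).le
  set u : ℕ → ℝ := fun i => (pathLaw κ 0).real {x | x i = 0} with hu
  have hrate' := hrate u pathLaw_real_coord_zero fun j => by
    simpa using pathLaw_real_coord_succ hκ j 0
  have hw1 := hw.pos 1
  refine ⟨C * w 1 * W + r * W, by positivity, fun j => ?_⟩
  have hbound : ∀ k, |(pathLaw κ 0).real {x | x (j + 1) = k} - statWeight κ k| ≤
      ∑ i ∈ Finset.range (j + 1), |u i - r| * p (j + 1 - i + k) +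
        r * tailSum p (k + (j + 1)) := by
    intro k
    have h1 : (pathLaw κ 0).real {x | x (j + 1) = k} - statWeight κ k =
        ∑ i ∈ Finset.range (j + 1), (u i - r) * p (j + 1 - i + k) -
          r * tailSum p (k + (j + 1)) := by
      rw [pathLaw_real_coord_succ hκ, statWeight, ← hp_def, ← hr, hp.tailSum_split k (j + 1)]
      simp only [sub_mul, Finset.sum_sub_distrib, ← Finset.mul_sum]
      ring
    rw [h1]
    refine (abs_sub _ _).trans (add_le_add ((Finset.abs_sum_le_sum_abs _ _).trans ?_) ?_)
    · refine Finset.sum_le_sum fun i _ => ?_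
      rw [abs_mul, abs_of_nonneg (hp.nonneg _)]
    · rw [abs_of_nonneg (mul_nonneg hr0 (hp.tailSum_nonneg _))]
  have hs1 : HasSum (fun k => ∑ i ∈ Finset.range (j + 1), |u i - r| * p (j + 1 - i + k))
      (∑ i ∈ Finset.range (j + 1), |u i - r| * tailSum p (j - i)) := by
    refine hasSum_sum fun i hi => HasSum.mul_left _ ?_
    rw [Finset.mem_range] at hi
    have : j + 1 - i = j - i + 1 := by omega
    rw [this]
    exact (hp.summable_shift _).hasSum
  have hs2 : HasSum (fun k => r * tailSum p (k + (j + 1)))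
      (r * ∑' k, tailSum p (k + (j + 1))) :=
    ((summable_nat_add_iff (f := tailSum p) (j + 1)).2 ht).hasSum.mul_left _
  have hs := hs1.add hs2
  calc _ ≤ ∑' k, ENNReal.ofReal (∑ i ∈ Finset.range (j + 1), |u i - r| * p (j + 1 - i + k) +
        r * tailSum p (k + (j + 1))) :=
        ENNReal.tsum_le_tsum fun k => ENNReal.ofReal_le_ofReal (hbound k)
    _ = ENNReal.ofReal (∑ i ∈ Finset.range (j + 1), |u i - r| * tailSum p (j - i) +
        r * ∑' k, tailSum p (k + (j + 1))) := by
        rw [← hs.tsum_eq, ENNReal.ofReal_tsum_of_nonneg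
          (fun k => (abs_nonneg _).trans (hbound k)) hs.summable]
    _ ≤ _ := by
        refine ENNReal.ofReal_le_ofReal ?_
        rw [add_div, mul_div_assoc r]
        exact add_le_add (hp.conv_tail_le hw htw hC hrate' j)
          (mul_le_mul_of_nonneg_left (hp.tsum_tailSum_add_le hw hmono htw _) hr0)

/-- The zero-delay process at time `j` is within `C / w j` of the stationary one. -/
theorem pathLaw_zero_shift_le (hp : IsAperiodicLaw fun j => κ.real {j}) {w : ℕ → ℝ}
    (hw : IsBeurlingWeight w) (hmono : Monotone w)
    (htw : Summable fun k => tailSum (fun j => κ.real {j}) k * w k) :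
    ∃ C : ℝ, 0 ≤ C ∧ ∀ (j : ℕ) (S : Set (ℕ → ℕ)), MeasurableSet S →
      pathLaw κ 0 (shift j ⁻¹' S) ≤
        ∑' k, ENNReal.ofReal (statWeight κ k) * pathLaw κ k S + ENNReal.ofReal (C / w j) := by
  obtain ⟨C, hC, h⟩ := tsum_abs_coord_sub_le hp hw hmono htw
  have hκ : κ {0} = 0 := (measureReal_eq_zero_iff (by finiteness)).1 hp.zero
  -- the maximum with `1` covers the time `j = 0`
  refine ⟨max C 1, le_max_of_le_left hC, fun j S hS => ?_⟩
  rcases j with _ | j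
  · refine prob_le_one.trans (le_add_of_nonneg_of_le zero_le ?_)
    rw [hw.zero, div_one]
    exact ENNReal.one_le_ofReal.2 (le_max_right _ _)
  · have hm := pathLaw_markov hκ hS (j + 1) 0 Set.univ MeasurableSet.univ (fun _ _ _ _ => trivial)
    simp only [Set.univ_inter] at hm
    rw [hm]
    refine (ENNReal.tsum_le_tsum (g := fun k => ENNReal.ofReal (statWeight κ k) * pathLaw κ k S +
      ENNReal.ofReal |(pathLaw κ 0).real {x | x (j + 1) = k} - statWeight κ k|)
      fun k => ?_).trans ?_
    · have h1 : pathLaw κ 0 {x | x (j + 1) = k} ≤ ENNReal.ofReal (statWeight κ k) +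
          ENNReal.ofReal |(pathLaw κ 0).real {x | x (j + 1) = k} - statWeight κ k| := by
        rw [← ofReal_measureReal]
        refine (ENNReal.ofReal_le_ofReal ?_).trans ENNReal.ofReal_add_le
        linarith [le_abs_self ((pathLaw κ 0).real {x | x (j + 1) = k} - statWeight κ k)]
      refine (mul_le_mul_left h1 _).trans ?_
      rw [add_mul]
      exact add_le_add le_rfl (mul_le_of_le_one_right' prob_le_one)
    · rw [ENNReal.tsum_add]
      refine add_le_add le_rfl ((h j).trans (ENNReal.ofReal_le_ofReal ?_))
      exact div_le_div_of_nonneg_right (le_max_left _ _) (hw.pos _).le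

end TotalVariation

/-! ### Moments of the interarrival law and of its tails -/

/-- Summation by parts: weights summed against tails are partial sums of the weights summed
against the law. Both moment identities for `ξ` are instances. -/
theorem tsum_mul_tail (κ : Measure ℕ) (V : ℕ → ℝ≥0∞) :
    ∑' k, V k * ∑' i, κ {k + 1 + i} = ∑' i, κ {i} * ∑ k ∈ Finset.range i, V k := by
  have h1 : ∀ k, ∑' i, κ {k + 1 + i} = ∑' i, if k < i then κ {i} else 0 := by
    intro k
    rw [← ENNReal.summable.sum_add_tsum_nat_add' (k := k + 1)
      (f := fun i => if k < i then κ {i} else 0), Finset.sum_eq_zero, zero_add]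
    · refine tsum_congr fun i => ?_
      rw [if_pos (by omega), add_comm i]
    · intro i hi
      rw [Finset.mem_range] at hi
      rw [if_neg (by omega)]
  have h2 : ∀ i, ∑ k ∈ Finset.range i, V k = ∑' k, if k < i then V k else 0 := by
    intro i
    rw [tsum_eq_sum (s := Finset.range i) fun k hk => if_neg (by simpa using hk)]
    exact Finset.sum_congr rfl fun k hk => (if_pos (by simpa using hk)).symm
  simp only [h1, h2, ← ENNReal.tsum_mul_left]
  rw [ENNReal.tsum_comm]
  refine tsum_congr fun i => tsum_congr fun k => ?_
  split_ifs <;> simp [mul_comm]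

section Moments

variable {κ : Measure ℕ} [IsProbabilityMeasure κ]

theorem ofReal_tailSum (hp : IsAperiodicLaw fun j => κ.real {j}) (k : ℕ) :
    ENNReal.ofReal (tailSum (fun j => κ.real {j}) k) = ∑' i, κ {k + 1 + i} := by
  rw [tailSum, ENNReal.ofReal_tsum_of_nonneg (fun i => hp.nonneg _) (hp.summable_shift (k + 1))]
  exact tsum_congr fun i => ofReal_measureReal

theorem tsum_ofReal_tailSum_mul (hp : IsAperiodicLaw fun j => κ.real {j}) (V : ℕ → ℝ) :
    ∑' k, ENNReal.ofReal (tailSum (fun j => κ.real {j}) k * V k) =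
      ∑' i, κ {i} * ∑ k ∈ Finset.range i, ENNReal.ofReal (V k) := by
  rw [← tsum_mul_tail]
  refine tsum_congr fun k => ?_
  rw [ENNReal.ofReal_mul (hp.tailSum_nonneg k), ofReal_tailSum hp, mul_comm]

theorem summable_tailSum_mul_weight (hp : IsAperiodicLaw fun j => κ.real {j}) {c : ℝ} (hc : 0 < c)
    (hint : ∑' i : ℕ, ENNReal.ofReal (i * F c i) * κ {i} ≠ ∞) :
    Summable fun k => tailSum (fun j => κ.real {j}) k * weight c k := by
  have hnn : ∀ k, 0 ≤ tailSum (fun j => κ.real {j}) k * weight c k := fun k =>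
    mul_nonneg (hp.tailSum_nonneg k) ((isBeurlingWeight_weight hc).pos k).le
  have hle : ∑' k, ENNReal.ofReal (tailSum (fun j => κ.real {j}) k * weight c k) ≠ ∞ := by
    refine ne_top_of_le_ne_top hint ?_
    rw [tsum_ofReal_tailSum_mul hp]
    refine ENNReal.tsum_le_tsum fun i => ?_
    rw [mul_comm]
    refine mul_le_mul_left ?_ _
    calc _ ≤ ∑ k ∈ Finset.range i, ENNReal.ofReal (F c i) := by
          refine Finset.sum_le_sum fun k hk => ENNReal.ofReal_le_ofReal ?_
          rw [Finset.mem_range] at hk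
          rw [weight_eq]
          exact F_natCast_mono hc hk
      _ = _ := by
          rw [Finset.sum_const, Finset.card_range, nsmul_eq_mul,
            ENNReal.ofReal_mul (Nat.cast_nonneg i), ENNReal.ofReal_natCast]
  exact (ENNReal.summable_toReal hle).congr fun k => ENNReal.toReal_ofReal (hnn k)

end Moments

theorem lintegral_eq_tsum_map {Ω : Type*} [MeasurableSpace Ω] {P : Measure Ω} {ξ : Ω → ℕ}
    (hξ : Measurable ξ) (g : ℕ → ℝ≥0∞) :
    ∫⁻ ω, g (ξ ω) ∂P = ∑' i, g i * P.map ξ {i} := by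
  rw [← lintegral_map (measurable_of_countable g) hξ, lintegral_countable']

theorem map_real_singleton {Ω : Type*} [MeasurableSpace Ω] {P : Measure Ω} {ξ : Ω → ℕ}
    (hξ : Measurable ξ) (i : ℕ) : (P.map ξ).real {i} = P.real {ω | ξ ω = i} := by
  rw [map_measureReal_apply hξ (measurableSet_singleton i)]
  rfl

section Interarrival

variable {Ω₀ : Type*} [MeasurableSpace Ω₀] {P : Measure Ω₀} [IsProbabilityMeasure P] {ξ : Ω₀ → ℕ}

theorem isAperiodicLaw_map (hξ : Measurable ξ) (haper : Aperiodic P ξ) (h0 : ∀ᵐ ω ∂P, ξ ω ≠ 0) :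
    IsAperiodicLaw fun j => (P.map ξ).real {j} := by
  have : IsProbabilityMeasure (P.map ξ) := Measure.isProbabilityMeasure_map hξ.aemeasurable
  refine ⟨fun _ => measureReal_nonneg, ?_, ?_, fun d hd => ?_⟩
  · rw [measureReal_eq_zero_iff, Measure.map_apply hξ (measurableSet_singleton 0)]
    exact measure_eq_zero_iff_ae_notMem.2 h0
  · have h1 : ∑' j, P.map ξ {j} = 1 := by
      simpa using (lintegral_countable' (μ := P.map ξ) fun _ => 1).symm
    have hne : ∑' j, P.map ξ {j} ≠ ∞ := by rw [h1]; exact ENNReal.one_ne_top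
    have h2 := ENNReal.hasSum_toReal hne
    rwa [← ENNReal.tsum_toReal_eq fun j => by finiteness, h1] at h2
  · have : d ∣ Nat.setGcd {k : ℕ | 1 ≤ k ∧ 0 < P {ω | ξ ω = k}} := by
      rw [Nat.dvd_setGcd_iff]
      rintro k ⟨-, hk⟩
      refine hd k ?_
      rw [map_real_singleton hξ]
      exact ENNReal.toReal_pos hk.ne' (by finiteness)
    rw [haper] at this
    exact Nat.dvd_one.1 this

theorem integral_eq_tsum_tailSum (hξ : Measurable ξ)
    (hp : IsAperiodicLaw fun j => (P.map ξ).real {j})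
    (ht : Summable (tailSum fun j => (P.map ξ).real {j})) :
    ∫ ω, (ξ ω : ℝ) ∂P = ∑' k, tailSum (fun j => (P.map ξ).real {j}) k := by
  have : IsProbabilityMeasure (P.map ξ) := Measure.isProbabilityMeasure_map hξ.aemeasurable
  have hm : Measurable fun ω => (ξ ω : ℝ) := (measurable_of_countable _).comp hξ
  rw [integral_eq_lintegral_of_nonneg_ae (Filter.Eventually.of_forall fun ω => Nat.cast_nonneg _)
    hm.aestronglyMeasurable]
  have h1 := lintegral_eq_tsum_map (P := P) hξ (fun i => (i : ℝ≥0∞))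
  have h2 := tsum_ofReal_tailSum_mul hp (fun _ => 1)
  simp only [ENNReal.ofReal_natCast]
  rw [h1]
  simp only [mul_one, ENNReal.ofReal_one, Finset.sum_const, Finset.card_range, nsmul_eq_mul,
    ← ENNReal.ofReal_tsum_of_nonneg hp.tailSum_nonneg ht] at h2
  simp only [mul_comm _ (P.map ξ _)]
  rw [← h2, ENNReal.toReal_ofReal (tsum_nonneg hp.tailSum_nonneg)]

theorem stationaryWeight_eq (hξ : Measurable ξ) (hp : IsAperiodicLaw fun j => (P.map ξ).real {j})
    (ht : Summable (tailSum fun j => (P.map ξ).real {j})) (k : ℕ) :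
    stationaryWeight P ξ k = statWeight (P.map ξ) k := by
  rw [stationaryWeight, statWeight, integral_eq_tsum_tailSum hξ hp ht]
  simp only [tailSum, map_real_singleton hξ]

end Interarrival

/-! ### The process on a general probability space -/

section Input

variable {Ω₀ Ω : Type*} [MeasurableSpace Ω₀] [MeasurableSpace Ω] {P : Measure Ω₀}
  {ξ : Ω₀ → ℕ} {μ : Measure Ω} {χ : Ω → ℕ} {ξs : ℕ → Ω → ℕ}

/-- The law of `Z` is the mixture of the laws with deterministic delay, weighted by the law of the
delay. -/
theorem IsRenewalInput.measure_path_mem [IsProbabilityMeasure μ]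
    (h : IsRenewalInput P ξ μ χ ξs) {S : Set (ℕ → ℕ)} (hS : MeasurableSet S) :
    μ {ω | (fun n => renewalZ χ ξs n ω) ∈ S} =
      ∑' k, μ {ω | χ ω = k} * pathLaw (P.map ξ) k S := by
  have hsm : Measurable fun ω i => ξs i ω := measurable_pi_lambda _ h.measurable_interarrival
  have hlaw : μ.map (fun ω i => ξs i ω) = Measure.infinitePi fun _ : ℕ => P.map ξ := by
    rw [h.iIndepFun.map_fun_eq_infinitePi_map h.measurable_interarrival]
    simp only [fun i => (h.identDistrib i).map_eq]
  have hunion : {ω | (fun n => renewalZ χ ξs n ω) ∈ S} =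
      ⋃ k, χ ⁻¹' {k} ∩ (fun ω i => ξs i ω) ⁻¹' (path k ⁻¹' S) := by
    ext ω
    simp [renewalZ_eq_path]
  rw [hunion, measure_iUnion]
  · refine tsum_congr fun k => ?_
    have hpk := measurable_path k hS
    rw [h.indep_delay.measure_inter_preimage_eq_mul _ _ (measurableSet_singleton k) hpk, pathLaw,
      Measure.map_apply (measurable_path k) hS, ← hlaw, Measure.map_apply hsm hpk]
    rfl
  · intro i j hij
    rw [Function.onFun, Set.disjoint_left]
    rintro ω ⟨hi, -⟩ ⟨hj, -⟩
    exact hij (hi.symm.trans hj)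
  · intro k
    exact (h.measurable_delay (measurableSet_singleton k)).inter (hsm (measurable_path k hS))

omit [MeasurableSpace Ω] in
theorem exists_of_measurableSet_sigmaOf {Z : ℕ → Ω → ℕ} {J : Set ℕ} {A : Set Ω}
    (hA : MeasurableSet[sigmaOf Z J] A) :
    ∃ D : Set (J → ℕ), MeasurableSet D ∧ A = {ω | (fun j : J => Z j ω) ∈ D} := by
  have h1 : sigmaOf Z J =
      MeasurableSpace.comap (fun ω (j : J) => Z j ω) inferInstance := by
    rw [MeasurableSpace.comap_process_pi (fun (j : J) ω => Z j ω), sigmaOf, iSup_subtype']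
    rfl
  rw [h1] at hA
  obtain ⟨D, hD, rfl⟩ := hA
  exact ⟨D, hD, rfl⟩

omit [MeasurableSpace Ω] in
/-- An event of the past `σ(Z_j : j ≤ m)` is described by a set of paths depending on the
coordinates `0, …, m`. -/
theorem exists_past {Z : ℕ → Ω → ℕ} {m : ℕ} {A : Set Ω}
    (hA : MeasurableSet[sigmaOf Z {j | j ≤ m}] A) :
    ∃ A' : Set (ℕ → ℕ), MeasurableSet A' ∧ DependsUpTo m A' ∧
      A = {ω | (fun n => Z n ω) ∈ A'} := by
  obtain ⟨D, hD, rfl⟩ := exists_of_measurableSet_sigmaOf hA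
  refine ⟨(fun x (j : {j | j ≤ m}) => x j) ⁻¹' D,
    measurable_pi_lambda _ (fun j => measurable_pi_apply _) hD, fun x y hxy hx => ?_, rfl⟩
  have : (fun j : {j | j ≤ m} => x j) = fun j : {j | j ≤ m} => y j :=
    funext fun j => hxy j j.2
  rw [Set.mem_preimage, ← this]
  exact hx

omit [MeasurableSpace Ω] in
/-- An event of the future `σ(Z_j : N ≤ j)` is described by a set of paths shifted by `N`. -/
theorem exists_future {Z : ℕ → Ω → ℕ} {N : ℕ} {B : Set Ω}
    (hB : MeasurableSet[sigmaOf Z {j | N ≤ j}] B) :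
    ∃ S : Set (ℕ → ℕ), MeasurableSet S ∧ B = {ω | shift N (fun n => Z n ω) ∈ S} := by
  obtain ⟨D, hD, rfl⟩ := exists_of_measurableSet_sigmaOf hB
  refine ⟨(fun x (j : {j | N ≤ j}) => x (j - N)) ⁻¹' D,
    measurable_pi_lambda _ (fun j => measurable_pi_apply _) hD, ?_⟩
  ext ω
  have : (fun j : {j | N ≤ j} => shift N (fun n => Z n ω) (j - N)) =
      fun j : {j | N ≤ j} => Z j ω :=
    funext fun j => by
      have : N ≤ (j : ℕ) := j.2
      simp only [shift, Nat.add_sub_cancel' this]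
  simp only [Set.mem_ofPred_eq, Set.mem_preimage, this]

end Input

/-! ### Decoupling -/

/-- The process with delay `k` is the zero-delay process started at time `k`. -/
theorem pathLaw_shift_of_le {κ : Measure ℕ} [IsProbabilityMeasure κ] (hκ : κ {0} = 0)
    {S : Set (ℕ → ℕ)} (hS : MeasurableSet S) (k : ℕ) :
    ∀ n, k ≤ n → pathLaw κ k (shift n ⁻¹' S) = pathLaw κ 0 (shift (n - k) ⁻¹' S) := by
  induction k with
  | zero => intro n _; rfl
  | succ k ih =>
    intro n hn
    obtain ⟨n, rfl⟩ := Nat.exists_eq_succ_of_ne_zero (by omega : n ≠ 0)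
    have h1 : consPath (k + 1) ⁻¹' (shift (n + 1) ⁻¹' S) = shift n ⁻¹' S := by
      ext x
      simp [shift_succ_consPath]
    rw [Nat.succ_eq_add_one, pathLaw_step hκ _ (measurable_shift _ hS),
      tsum_eq_single k (fun l hl => by simp [trans, hl]), h1, ih n (by omega),
      Nat.add_sub_add_right]
    simp [trans]

/-- The decoupling inequality on path space, for a process started from the stationary law. -/
theorem decoupling_path {κ : Measure ℕ} [IsProbabilityMeasure κ]
    (hp : IsAperiodicLaw fun j => κ.real {j}) {w : ℕ → ℝ}
    (hw : IsBeurlingWeight w) (hmono : Monotone w)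
    (htw : Summable fun k => tailSum (fun j => κ.real {j}) k * w k) :
    ∃ C : ℝ, 0 ≤ C ∧ ∀ (n m : ℕ) (A S : Set (ℕ → ℕ)), MeasurableSet A → DependsUpTo m A →
      MeasurableSet S →
      ∑' k, ENNReal.ofReal (statWeight κ k) * pathLaw κ k (A ∩ shift (m + 2 * n) ⁻¹' S) ≤
        (∑' k, ENNReal.ofReal (statWeight κ k) * pathLaw κ k A) *
          (∑' k, ENNReal.ofReal (statWeight κ k) * pathLaw κ k S) + ENNReal.ofReal (C / w n) := by
  obtain ⟨C, hC, htv⟩ := pathLaw_zero_shift_le hp hw hmono htw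
  have hκ : κ {0} = 0 := (measureReal_eq_zero_iff (by finiteness)).1 hp.zero
  have ht : Summable (tailSum fun j => κ.real {j}) := htw.of_nonneg_of_le hp.tailSum_nonneg
    fun k => le_mul_of_one_le_right (hp.tailSum_nonneg k) (hw.one_le k)
  set q : ℕ → ℝ≥0∞ := fun k => ENNReal.ofReal (statWeight κ k) with hq
  set M := ∑' i, tailSum (fun j => κ.real {j}) i with hM
  set W := ∑' k, tailSum (fun j => κ.real {j}) k * w k with hW
  have hW0 : 0 ≤ W := tsum_nonneg fun k => mul_nonneg (hp.tailSum_nonneg k) (hw.pos k).le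
  have hM1 : 1 ≤ M := by
    rw [← hp.tailSum_zero]
    exact ht.le_tsum 0 fun n _ => hp.tailSum_nonneg n
  have hM0 : 0 ≤ 1 / M := by positivity
  have hstat : ∀ k, statWeight κ k = 1 / M * tailSum (fun j => κ.real {j}) k := fun k => rfl
  have hq1 : ∑' k, q k = 1 := by
    simp only [hq, hstat]
    rw [← ENNReal.ofReal_tsum_of_nonneg (fun k => mul_nonneg hM0 (hp.tailSum_nonneg k))
      (ht.mul_left _), tsum_mul_left, ← hM, one_div_mul_cancel (by positivity), ENNReal.ofReal_one]
  -- the delay at a fixed time is at least `n` with probability `O(1 / w n)`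
  have htail : ∀ n, ∑' j, (if n ≤ j then q j else 0) ≤ ENNReal.ofReal (1 / M * W / w n) := by
    intro n
    rw [← ENNReal.summable.sum_add_tsum_nat_add' (k := n), Finset.sum_eq_zero, zero_add]
    · simp only [Nat.le_add_left, if_true, hq, hstat]
      rw [← ENNReal.ofReal_tsum_of_nonneg (fun k => mul_nonneg hM0 (hp.tailSum_nonneg _))
        (((summable_nat_add_iff n).2 ht).mul_left _), tsum_mul_left, mul_div_assoc]
      exact ENNReal.ofReal_le_ofReal
        (mul_le_mul_of_nonneg_left (hp.tsum_tailSum_add_le hw hmono htw n) hM0)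
    · intro i hi
      rw [Finset.mem_range] at hi
      exact if_neg (by omega)
  refine ⟨C + 1 / M * W, by positivity, fun n m A S hA hAm hS => ?_⟩
  set L := ∑' k, q k * pathLaw κ k S with hL
  set T : ℕ → ℝ≥0∞ := fun j => ∑' k, q k * pathLaw κ k (A ∩ {x | x m = j}) with hT
  have hmarkov : ∀ U : Set (ℕ → ℕ), MeasurableSet U →
      ∑' k, q k * pathLaw κ k (A ∩ shift m ⁻¹' U) = ∑' j, T j * pathLaw κ j U := by
    intro U hU
    simp only [pathLaw_markov hκ hU m _ A hA hAm, hT, ← ENNReal.tsum_mul_left,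
      ← ENNReal.tsum_mul_right]
    rw [ENNReal.tsum_comm]
    simp only [mul_assoc]
  have hTsum : ∑' j, T j = ∑' k, q k * pathLaw κ k A := by
    simpa using (hmarkov Set.univ MeasurableSet.univ).symm
  -- by stationarity `Z m` has the law `q`
  have hTle : ∀ j, T j ≤ q j := by
    intro j
    have h0 : shift m ⁻¹' {x | x 0 = j} = {x | x m = j} := rfl
    calc T j ≤ ∑' k, q k * pathLaw κ k (shift m ⁻¹' {x | x 0 = j}) := by
          rw [h0]
          exact ENNReal.tsum_le_tsum fun k =>
            mul_le_mul_right (measure_mono Set.inter_subset_right) _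
      _ = ∑' k, q k * pathLaw κ k {x | x 0 = j} :=
          tsum_pathLaw_shift hκ (statWeight_stationary hp) m (measurableSet_coord 0 j)
      _ = q j * pathLaw κ j {x | x 0 = j} := by
          refine tsum_eq_single j fun k hk => ?_
          rw [measure_eq_zero_iff_ae_notMem.2, mul_zero]
          filter_upwards [pathLaw_start k] with x hx
          simp [hx, hk]
      _ ≤ q j := mul_le_of_le_one_right' prob_le_one
  have hTA : ∑' k, q k * pathLaw κ k A ≤ 1 := by
    rw [← hq1]
    exact ENNReal.tsum_le_tsum fun k => mul_le_of_le_one_right' prob_le_one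
  have hshift : shift (m + 2 * n) ⁻¹' S = shift m ⁻¹' (shift (2 * n) ⁻¹' S) := by
    ext x
    simp [shift_shift]
  have hterm : ∀ j, T j * pathLaw κ j (shift (2 * n) ⁻¹' S) ≤
      T j * (L + ENNReal.ofReal (C / w n)) + if n ≤ j then q j else 0 := by
    intro j
    by_cases hj : n ≤ j
    · rw [if_pos hj]
      exact le_add_of_nonneg_of_le zero_le ((mul_le_of_le_one_right' prob_le_one).trans (hTle j))
    · rw [if_neg hj, add_zero, pathLaw_shift_of_le hκ hS j (2 * n) (by omega)]
      refine mul_le_mul_right ((htv _ S hS).trans (add_le_add le_rfl ?_)) _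
      refine ENNReal.ofReal_le_ofReal (div_le_div_of_nonneg_left hC (hw.pos n) (hmono ?_))
      omega
  rw [hshift, hmarkov _ (measurable_shift _ hS)]
  calc _ ≤ ∑' j, (T j * (L + ENNReal.ofReal (C / w n)) + if n ≤ j then q j else 0) :=
        ENNReal.tsum_le_tsum hterm
    _ ≤ (∑' k, q k * pathLaw κ k A) * (L + ENNReal.ofReal (C / w n)) +
        ENNReal.ofReal (1 / M * W / w n) := by
        rw [ENNReal.tsum_add, ENNReal.tsum_mul_right, hTsum]
        exact add_le_add le_rfl (htail n)
    _ ≤ (∑' k, q k * pathLaw κ k A) * L + ENNReal.ofReal (C / w n) +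
        ENNReal.ofReal (1 / M * W / w n) := by
        rw [mul_add]
        exact add_le_add (add_le_add le_rfl (mul_le_of_le_one_left' hTA)) le_rfl
    _ = _ := by
        rw [add_assoc, ← ENNReal.ofReal_add (div_nonneg hC (hw.pos n).le)
          (div_nonneg (by positivity) (hw.pos n).le), ← add_div]

end RenewalDecoupling

open RenewalDecoupling

theorem mainTheorem2 {Ω₀ : Type*} [MeasurableSpace Ω₀] (P : Measure Ω₀) [IsProbabilityMeasure P]
    (ξ : Ω₀ → ℕ) (hξ : Measurable ξ) (c : ℝ) (hc : 0 < c)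
    (haper : RenewalDecoupling.Aperiodic P ξ)
    (hval : ∀ᵐ ω ∂P, RenewalDecoupling.cTilde c < (ξ ω : ℝ))
    (hint : Integrable (fun ω => (ξ ω : ℝ) * RenewalDecoupling.F c (ξ ω)) P) :
    ∃ c₁ : ℝ, 0 < c₁ ∧
      ∀ {Ω : Type*} [MeasurableSpace Ω] (μ : Measure Ω) [IsProbabilityMeasure μ]
        (ρ : Ω → ℕ) (ξs : ℕ → Ω → ℕ),
        RenewalDecoupling.IsRenewalInput P ξ μ ρ ξs →
        RenewalDecoupling.IsStationaryDelay P ξ μ ρ →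
        ∀ (n m : ℕ) (A B : Set Ω),
          MeasurableSet[RenewalDecoupling.sigmaOf (RenewalDecoupling.renewalZ ρ ξs)
            {j | j ≤ m}] A →
          MeasurableSet[RenewalDecoupling.sigmaOf (RenewalDecoupling.renewalZ ρ ξs)
            {j | m + 2 * n ≤ j}] B →
          μ.real (A ∩ B) ≤ μ.real A * μ.real B + c₁ / RenewalDecoupling.F c n := by
  have : IsProbabilityMeasure (P.map ξ) := Measure.isProbabilityMeasure_map hξ.aemeasurable
  have h0 : ∀ᵐ ω ∂P, ξ ω ≠ 0 := by
    filter_upwards [hval] with ω hω h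
    rw [h, Nat.cast_zero] at hω
    exact absurd hω (not_lt.2 ((Real.exp_pos _).le.trans (le_max_right _ _)))
  have hp := isAperiodicLaw_map hξ haper h0
  have hw := isBeurlingWeight_weight hc
  have hfin : ∑' i : ℕ, ENNReal.ofReal (i * F c i) * P.map ξ {i} ≠ ⊤ := by
    rw [← lintegral_eq_tsum_map hξ fun i => ENNReal.ofReal (i * F c i)]
    exact hint.lintegral_lt_top.ne
  have htw := summable_tailSum_mul_weight hp hc hfin
  have ht : Summable (tailSum fun j => (P.map ξ).real {j}) := htw.of_nonneg_of_le
    hp.tailSum_nonneg fun k => le_mul_of_one_le_right (hp.tailSum_nonneg k) (hw.one_le k)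
  have hκ : P.map ξ {0} = 0 := (measureReal_eq_zero_iff (by finiteness)).1 hp.zero
  obtain ⟨C, hC, hdec⟩ := decoupling_path hp hw (weight_mono hc) htw
  refine ⟨C + 1, by positivity, fun {Ω} _ μ _ ρ ξs hin hst n m A B hA hB => ?_⟩
  obtain ⟨A, hAm, hAdep, rfl⟩ := exists_past hA
  obtain ⟨S, hS, rfl⟩ := exists_future hB
  have hq : ∀ k, μ {ω | ρ ω = k} = ENNReal.ofReal (statWeight (P.map ξ) k) := fun k => by
    rw [← stationaryWeight_eq hξ hp ht, ← hst k, ofReal_measureReal]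
  have hlaw : ∀ U : Set (ℕ → ℕ), MeasurableSet U → μ {ω | (fun n => renewalZ ρ ξs n ω) ∈ U} =
      ∑' k, ENNReal.ofReal (statWeight (P.map ξ) k) * pathLaw (P.map ξ) k U := fun U hU => by
    simp only [hin.measure_path_mem hU, hq]
  have hSm := measurable_shift (m + 2 * n) hS
  have h1 := hdec n m A S hAm hAdep hS
  rw [← hlaw _ (hAm.inter hSm), ← hlaw _ hAm,
    ← tsum_pathLaw_shift hκ (statWeight_stationary hp) (m + 2 * n) hS, ← hlaw _ hSm] at h1
  have hF : 0 < F c n := Real.exp_pos _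
  have h2 := ENNReal.toReal_mono (by finiteness) h1
  rw [ENNReal.toReal_add (by finiteness) (by finiteness), ENNReal.toReal_mul,
    ENNReal.toReal_ofReal (div_nonneg hC (hw.pos n).le)] at h2
  refine h2.trans (add_le_add le_rfl ?_)
  exact div_le_div₀ (by positivity) (by linarith) hF (F_le_weight hc n)
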